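/- **Hopf fibration of the quantum 3-sphere.** Let $q\in\mathbb R$, $q\neq 0$. All algebras are unital associative over $\mathbb C$. *Data.* For $n\ge 1$ let $R_n=q^{-1/n}\bigl(q\sum_iE_{ii}\otimes E_{ii}+\sum_{i\ne j}E_{ii}\otimes E_{jj}+(q-q^{-1})\sum_{i<j}E_{ij}\otimes E_{ji}\bigr)$, $\lambda_n=q^{1-1/n}$, $\widetilde R_n=((R_n^{t_2})^{-1})^{t_2}$ ($t_2$ = transposition in the second tensor factor), $g^b{}_a=\lambda_n\sum_c\widetilde R_n{}^{bc}{}_{ca}$ (for $q<0$ one fixes a branch of the power; only expressions independent of it occur below). - The quantum sphere $S_q^{2n-1}$ is the $*$-algebra with generators $v^i,x_i$ $(1\le i\le n)$, involution $x_i^*=v^i$, and relations (summation over repeated indices) $v^iv^j=\lambda_n^{-1}R_n{}^{ij}{}_{kl}\,v^lv^k$, $\;x_ix_j=\lambda_n^{-1}R_n{}^{kl}{}_{ij}\,x_lx_k$, $\;x_iv^j=\lambda_n\widetilde R_n{}^{lj}{}_{ik}\,v^kx_l$, $\;v^ag^b{}_ax_b=1$. - $SU_q(2)$ is the Hopf $*$-algebra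 with generators $t^i{}_j$ $(1\le i,j\le 2)$, relations $R_2{}^{ij}{}_{kl}t^k{}_mt^l{}_p=t^j{}_lt^i{}_kR_2{}^{kl}{}_{mp}$ and $\det_q=1$, where $\det_q=\nu^{-1}\varepsilon_{ab}\,t^a{}_ct^b{}_d\,\varepsilon^{dc}$, $\varepsilon_{12}=\varepsilon^{12}=1$, $\varepsilon_{21}=\varepsilon^{21}=-q$, $\varepsilon_{11}=\varepsilon_{22}=\varepsilon^{11}=\varepsilon^{22}=0$, $\nu=\varepsilon_{ab}\varepsilon^{ba}$; $\Delta t^i{}_j=\sum_kt^i{}_k\otimes t^k{}_j$, $\varepsilon(t^i{}_j)=\delta^i_j$, and $(t^a{}_b)^*=S\,t^b{}_a$. - $U_q(1)=\mathbb C[z,z^{-1}]$ with $z^*=z^{-1}$, $\Delta z=z\otimes z$. $S^1_q$ carries the Hopf algebra structure in which $x_1$ is group-like. - The (standard) Podleś sphere $S_q^2$ is the $*$-algebra generated by $A=A^*$ and $B$ with $B^*B=A-A^2$, $BB^*=q^2A-q^4A^2$, $BA=q^2AB$. For a Hopf algebra $H$ and a left $H$-comodule algebra $P$ with coaction $\beta:P\to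 H\otimes P$ (an algebra map) put $P^H=\{u\in P:\beta(u)=1\otimes u\}$ and $\chi:P\otimes P\to H\otimes P$, $\chi(u\otimes w)=\beta(u)(1\otimes w)$. $P$ is a *quantum principal bundle* with structure quantum group $H$ and base $B=P^H$ if $\chi$ is surjective (freeness) and the kernel of the restriction of $\chi$ to the universal 1-forms $\Omega^1P=\ker(P\otimes P\to P)$ is the space $P\,(dB)\,P$ of horizontal forms, $db=1\otimes b-b\otimes 1$ (exactness). A surjective Hopf algebra map $\pi:P\to H$ is *exact* if, for the coaction $(\pi\otimes\mathrm{id})\Delta$ and $B=P^H$, $\ker\pi$ is contained in the span of the products $bu$ with $b\in B$, $\pi(b)=0$, $u\in P$. *Claim.* 1. There is an isomorphism of $*$-algebras $\Theta:S_q^3\to SU_q(2)$ with $\Theta(x_i)=t^2{}_i$, and an isomorphism of Hopf $*$-algebras $\varphi:S_q^1\to U_q(1)$ with $\varphi(x_1)=z$. 2. There is a surjective and exact Hopf $*$-algebra map $\delta:SU_q(2)\to U_q(1)$ with $\delta(t^1{}_1)=z^*$, $\delta(t^2{}_2)=z$, $\delta(t^1{}_2)=\delta(t^2{}_1)=0$.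 3. There is a left coaction $\beta:S_q^3\to S_q^1\otimes S_q^3$ which is a $*$-algebra map, satisfies $\beta(x_i)=x_1\otimes x_i$ and $(\varphi\otimes\Theta)\circ\beta=(\delta\otimes\mathrm{id})\circ\Delta\circ\Theta$, and makes $S_q^3$ a quantum principal bundle with structure quantum group $S_q^1\cong U_q(1)$; its base $(S_q^3)^{S_q^1}$ is isomorphic, as a $*$-algebra, to the Podleś sphere: $$S_q^2\cong (S_q^3)^{S_q^1}.$$ -/

import Mathlib

open scoped TensorProduct Kronecker LaurentPolynomial

set_option linter.unusedSectionVars false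

noncomputable section

namespace QuantumHopf

/-! ### Conjugate-linear involutions on presented algebras -/

/-- The opposite of a complex algebra `A` with scalars acting through complex conjugation: an
algebra homomorphism `A → ConjOp A` is a conjugate-linear anti-homomorphism `A → A`. -/
def ConjOp (A : Type*) : Type _ := Aᵐᵒᵖ

namespace ConjOp
variable {A : Type*} [Ring A] [Algebra ℂ A]

instance : Ring (ConjOp A) := inferInstanceAs (Ring Aᵐᵒᵖ)

def mk (a : A) : ConjOp A := MulOpposite.op a

def out (a : ConjOp A) : A := MulOpposite.unop a

instance : Algebra ℂ (ConjOp A) :=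
  RingHom.toAlgebra' (S := ConjOp A)
    (((algebraMap ℂ Aᵐᵒᵖ).comp (starRingEnd ℂ) : ℂ →+* Aᵐᵒᵖ) : ℂ →+* ConjOp A)
    (fun c x => Algebra.commutes (A := Aᵐᵒᵖ) ((starRingEnd ℂ) c) x)

@[simp] theorem out_mk (a : A) : out (mk a) = a := rfl
@[simp] theorem mk_out (a : ConjOp A) : mk (out a) = a := rfl
@[simp] theorem out_add (a b : ConjOp A) : out (a + b) = out a + out b := rfl
@[simp] theorem out_sub (a b : ConjOp A) : out (a - b) = out a - out b := rfl
@[simp] theorem out_neg (a : ConjOp A) : out (-a) = -out a := rfl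
@[simp] theorem out_zero : out (0 : ConjOp A) = 0 := rfl
@[simp] theorem out_one : out (1 : ConjOp A) = 1 := rfl
@[simp] theorem out_mul (a b : ConjOp A) : out (a * b) = out b * out a := rfl
theorem out_injective : Function.Injective (out : ConjOp A → A) := fun _ _ h => MulOpposite.unop_injective h
@[simp] theorem out_algebraMap (c : ℂ) :
    out (algebraMap ℂ (ConjOp A) c) = algebraMap ℂ A ((starRingEnd ℂ) c) := rfl
@[simp] theorem out_smul (c : ℂ) (a : ConjOp A) :
    out (c • a) = (starRingEnd ℂ) c • out a := by
  rw [Algebra.smul_def, out_mul, out_algebraMap, Algebra.smul_def, Algebra.commutes]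
@[simp] theorem out_sum {ι : Type*} (s : Finset ι) (f : ι → ConjOp A) :
    out (∑ i ∈ s, f i) = ∑ i ∈ s, out (f i) :=
  map_sum (⟨⟨out, rfl⟩, fun _ _ => rfl⟩ : ConjOp A →+ A) f s

/-- The square of a conjugate-linear anti-homomorphism. -/
def square (f : A →ₐ[ℂ] ConjOp A) : A →ₐ[ℂ] A where
  toFun a := out (f (out (f a)))
  map_one' := by simp
  map_mul' := by simp
  map_zero' := by simp
  map_add' := by simp
  commutes' c := by simp

@[simp] theorem square_apply (f : A →ₐ[ℂ] ConjOp A) (a : A) :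
    square f a = out (f (out (f a))) := rfl

/-- The `⋆`-ring structure defined by an involutive conjugate-linear anti-homomorphism. -/
@[reducible] def starRing (f : A →ₐ[ℂ] ConjOp A) (h : square f = AlgHom.id ℂ A) : StarRing A where
  star a := out (f a)
  star_involutive a := congrArg (fun g : A →ₐ[ℂ] A => g a) h
  star_mul := by simp
  star_add := by simp

end ConjOp

/-! ### Hopf algebra structure from an anti-homomorphism on generators -/

section antipode
variable {A : Type*} [Ring A] [Bialgebra ℂ A]

/-- The linear endomorphism underlying an anti-endomorphism. -/
def antiLin (S : A →ₐ[ℂ] Aᵐᵒᵖ) : A →ₗ[ℂ] A :=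
  (MulOpposite.opLinearEquiv ℂ (M := A)).symm.toLinearMap ∘ₗ S.toLinearMap

@[simp] theorem antiLin_apply (S : A →ₐ[ℂ] Aᵐᵒᵖ) (a : A) : antiLin S a = (S a).unop := rfl

theorem antipode_left (S : A →ₐ[ℂ] Aᵐᵒᵖ) (s : Set A) (hs : Algebra.adjoin ℂ s = ⊤)
    (h : ∀ x ∈ s, LinearMap.mul' ℂ A ((antiLin S).rTensor A (Coalgebra.comul x)) =
      algebraMap ℂ A (Coalgebra.counit x)) :
    LinearMap.mul' ℂ A ∘ₗ (antiLin S).rTensor A ∘ₗ Coalgebra.comul =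
      Algebra.linearMap ℂ A ∘ₗ Coalgebra.counit := by
  have key : ∀ w w' : A ⊗[ℂ] A, ∀ c : ℂ,
      LinearMap.mul' ℂ A ((antiLin S).rTensor A w) = algebraMap ℂ A c →
      LinearMap.mul' ℂ A ((antiLin S).rTensor A (w * w')) =
        c • LinearMap.mul' ℂ A ((antiLin S).rTensor A w') := by
    intro w w' c hw
    induction w' with
    | zero => simp
    | add u v hu hv => simp [mul_add, hu, hv]
    | tmul u v =>
      have : ∀ w : A ⊗[ℂ] A, LinearMap.mul' ℂ A ((antiLin S).rTensor A (w * u ⊗ₜ[ℂ] v)) =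
          (S u).unop * LinearMap.mul' ℂ A ((antiLin S).rTensor A w) * v := by
        intro w
        induction w with
        | zero => simp
        | add a b ha hb => simp [add_mul, mul_add, ha, hb]
        | tmul a b => simp [mul_assoc]
      rw [this, hw]
      simp [Algebra.algebraMap_eq_smul_one]
  ext x
  have hx : x ∈ Algebra.adjoin ℂ s := by rw [hs]; trivial
  induction hx using Algebra.adjoin_induction with
  | mem x hx => simpa using h x hx
  | algebraMap r =>
    simp [Algebra.TensorProduct.algebraMap_apply]
  | add x y _ _ hx hy => simp only [map_add, hx, hy]
  | mul x y _ _ hx hy =>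
    simp only [LinearMap.comp_apply, Algebra.linearMap_apply] at hx hy ⊢
    rw [Bialgebra.comul_mul, key _ _ _ hx, hy, Bialgebra.counit_mul, map_mul,
      Algebra.smul_def]

theorem antipode_right (S : A →ₐ[ℂ] Aᵐᵒᵖ) (s : Set A) (hs : Algebra.adjoin ℂ s = ⊤)
    (h : ∀ x ∈ s, LinearMap.mul' ℂ A ((antiLin S).lTensor A (Coalgebra.comul x)) =
      algebraMap ℂ A (Coalgebra.counit x)) :
    LinearMap.mul' ℂ A ∘ₗ (antiLin S).lTensor A ∘ₗ Coalgebra.comul =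
      Algebra.linearMap ℂ A ∘ₗ Coalgebra.counit := by
  have key : ∀ w w' : A ⊗[ℂ] A, ∀ c : ℂ,
      LinearMap.mul' ℂ A ((antiLin S).lTensor A w') = algebraMap ℂ A c →
      LinearMap.mul' ℂ A ((antiLin S).lTensor A (w * w')) =
        c • LinearMap.mul' ℂ A ((antiLin S).lTensor A w) := by
    intro w w' c hw
    induction w with
    | zero => simp
    | add u v hu hv => simp [add_mul, hu, hv]
    | tmul u v =>
      have : ∀ w : A ⊗[ℂ] A, LinearMap.mul' ℂ A ((antiLin S).lTensor A (u ⊗ₜ[ℂ] v * w)) =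
          u * LinearMap.mul' ℂ A ((antiLin S).lTensor A w) * (S v).unop := by
        intro w
        induction w with
        | zero => simp
        | add a b ha hb => simp [add_mul, mul_add, ha, hb]
        | tmul a b => simp [mul_assoc]
      rw [this, hw]
      simp [Algebra.algebraMap_eq_smul_one]
  ext x
  have hx : x ∈ Algebra.adjoin ℂ s := by rw [hs]; trivial
  induction hx using Algebra.adjoin_induction with
  | mem x hx => simpa using h x hx
  | algebraMap r =>
    simp [Algebra.TensorProduct.algebraMap_apply]
  | add x y _ _ hx hy => simp only [map_add, hx, hy]
  | mul x y _ _ hx hy =>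
    simp only [LinearMap.comp_apply, Algebra.linearMap_apply] at hx hy ⊢
    rw [Bialgebra.comul_mul, key _ _ _ hy, hx, Bialgebra.counit_mul, map_mul,
      Algebra.smul_def, Algebra.commutes]

/-- A bialgebra with an anti-endomorphism satisfying the antipode identities on generators is a
Hopf algebra. -/
@[reducible] def hopfOfGenerators (S : A →ₐ[ℂ] Aᵐᵒᵖ) (s : Set A) (hs : Algebra.adjoin ℂ s = ⊤)
    (hl : ∀ x ∈ s, LinearMap.mul' ℂ A ((antiLin S).rTensor A (Coalgebra.comul x)) =
      algebraMap ℂ A (Coalgebra.counit x))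
    (hr : ∀ x ∈ s, LinearMap.mul' ℂ A ((antiLin S).lTensor A (Coalgebra.comul x)) =
      algebraMap ℂ A (Coalgebra.counit x)) : HopfAlgebra ℂ A where
  antipode := antiLin S
  mul_antipode_rTensor_comul := antipode_left S s hs hl
  mul_antipode_lTensor_comul := antipode_right S s hs hr

end antipode

theorem adjoin_ringQuot {X : Type*} (r : FreeAlgebra ℂ X → FreeAlgebra ℂ X → Prop) :
    Algebra.adjoin ℂ (Set.range fun i => RingQuot.mkAlgHom ℂ r (FreeAlgebra.ι ℂ i)) = ⊤ := by
  have : (Set.range fun i => RingQuot.mkAlgHom ℂ r (FreeAlgebra.ι ℂ i)) =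
      RingQuot.mkAlgHom ℂ r '' Set.range (FreeAlgebra.ι ℂ) := by
    rw [← Set.range_comp]; rfl
  rw [this, ← AlgHom.map_adjoin, FreeAlgebra.adjoin_range_ι, Algebra.map_top]
  exact (AlgHom.range_eq_top _).2 (RingQuot.mkAlgHom_surjective ℂ r)

/-! ### The standard R-matrices -/

/-- The standard R-matrix
`q^(-1/n) (q ∑ᵢ Eᵢᵢ ⊗ Eᵢᵢ + ∑_{i ≠ j} Eᵢᵢ ⊗ Eⱼⱼ + (q - q⁻¹) ∑_{i < j} Eᵢⱼ ⊗ Eⱼᵢ)`; the entry with row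
`(a, b)` and column `(c, d)` is `R^{ab}_{cd}`. -/
def Rmat (n : ℕ) (q : ℝ) : Matrix (Fin n × Fin n) (Fin n × Fin n) ℂ :=
  ((q : ℂ) ^ (-(1 / n : ℂ))) •
    ((q : ℂ) • ∑ i, Matrix.single i i (1 : ℂ) ⊗ₖ Matrix.single i i (1 : ℂ)
      + ∑ i, ∑ j, (if i ≠ j then Matrix.single i i (1 : ℂ) ⊗ₖ Matrix.single j j (1 : ℂ) else 0)
      + ((q : ℂ) - (q : ℂ)⁻¹) •
        ∑ i, ∑ j, (if i < j then Matrix.single i j (1 : ℂ) ⊗ₖ Matrix.single j i (1 : ℂ) else 0))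

/-- The normalisation factor `λ_n = q^(1 - 1/n)`. -/
def lam (n : ℕ) (q : ℝ) : ℂ := (q : ℂ) ^ (1 - 1 / n : ℂ)

/-- Transposition in the second tensor factor. -/
def transpose₂ {n : ℕ} (M : Matrix (Fin n × Fin n) (Fin n × Fin n) ℂ) :
    Matrix (Fin n × Fin n) (Fin n × Fin n) ℂ :=
  Matrix.of fun x y => M (x.1, y.2) (y.1, x.2)

/-- `R̃ = ((R^{t₂})⁻¹)^{t₂}`. -/
def Rtilde (n : ℕ) (q : ℝ) : Matrix (Fin n × Fin n) (Fin n × Fin n) ℂ :=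
  transpose₂ (transpose₂ (Rmat n q))⁻¹

/-- The quantum metric `g^b_a = λ_n ∑_c R̃^{bc}_{ca}`. -/
def metric (n : ℕ) (q : ℝ) (b a : Fin n) : ℂ := lam n q * ∑ c, Rtilde n q (b, c) (c, a)

/-- The matrix in brackets in the definition of `Rmat`. -/
def Rcore (n : ℕ) (q : ℝ) : Matrix (Fin n × Fin n) (Fin n × Fin n) ℝ :=
  Matrix.of fun x y =>
    if x = y then (if x.1 = x.2 then q else 1)
    else if x.1 = y.2 ∧ x.2 = y.1 ∧ x.1 < x.2 then q - q⁻¹ else 0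

theorem Rmat_eq (n : ℕ) (q : ℝ) :
    Rmat n q = ((q : ℂ) ^ (-(1 / n : ℂ))) • (Rcore n q).map (algebraMap ℝ ℂ) := by
  unfold Rmat
  congr 1
  ext ⟨a, b⟩ ⟨c, d⟩
  simp only [Matrix.add_apply, Matrix.smul_apply, Matrix.sum_apply, Matrix.map_apply, Rcore,
    Matrix.of_apply, smul_eq_mul]
  have e1 : ∑ i, (Matrix.single i i (1 : ℂ) ⊗ₖ Matrix.single i i (1 : ℂ)) (a, b) (c, d) =
      if a = c ∧ b = d ∧ a = b then 1 else 0 := by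
    rw [Finset.sum_eq_single a]
    · simp only [Matrix.kroneckerMap_apply, Matrix.single_apply]; grind
    · intro i _ hi
      simp only [Matrix.kroneckerMap_apply, Matrix.single_apply]; grind
    · simp
  have e2 : ∑ i, ∑ j, (if i ≠ j then Matrix.single i i (1 : ℂ) ⊗ₖ Matrix.single j j (1 : ℂ)
      else 0) (a, b) (c, d) = if a = c ∧ b = d ∧ a ≠ b then 1 else 0 := by
    rw [Finset.sum_eq_single a, Finset.sum_eq_single b]
    · by_cases h : a = b
      · simp [h]
      · simp only [ne_eq, h, not_false_eq_true, if_true, Matrix.kroneckerMap_apply,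
          Matrix.single_apply]; grind
    · intro i _ hi
      split_ifs
      · simp only [Matrix.kroneckerMap_apply, Matrix.single_apply]; grind
      · rfl
    · simp
    · intro i _ hi
      refine Finset.sum_eq_zero fun j _ => ?_
      split_ifs
      · simp only [Matrix.kroneckerMap_apply, Matrix.single_apply]; grind
      · rfl
    · simp
  have e3 : ∑ i, ∑ j, (if i < j then Matrix.single i j (1 : ℂ) ⊗ₖ Matrix.single j i (1 : ℂ)
      else 0) (a, b) (c, d) = if a = d ∧ b = c ∧ a < b then 1 else 0 := by
    rw [Finset.sum_eq_single a, Finset.sum_eq_single b]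
    · by_cases h : a < b
      · simp only [h, if_true, Matrix.kroneckerMap_apply, Matrix.single_apply]; grind
      · simp [h]
    · intro i _ hi
      split_ifs
      · simp only [Matrix.kroneckerMap_apply, Matrix.single_apply]; grind
      · rfl
    · simp
    · intro i _ hi
      refine Finset.sum_eq_zero fun j _ => ?_
      split_ifs
      · simp only [Matrix.kroneckerMap_apply, Matrix.single_apply]; grind
      · rfl
    · simp
  rw [e1, e2, e3]
  by_cases h1 : a = c <;> by_cases h2 : b = d <;> by_cases h3 : a = b <;>
    by_cases h4 : a = d <;> by_cases h5 : b = c <;> by_cases h6 : a < b <;>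
    simp_all
  split_ifs <;> simp

theorem transpose₂_smul {n : ℕ} (c : ℂ) (M : Matrix (Fin n × Fin n) (Fin n × Fin n) ℂ) :
    transpose₂ (c • M) = c • transpose₂ M := rfl

theorem inv_smul_matrix {m : Type*} [Fintype m] [DecidableEq m] (c : ℂ) (hc : c ≠ 0)
    (M : Matrix m m ℂ) : (c • M)⁻¹ = c⁻¹ • M⁻¹ := by
  by_cases h : IsUnit M.det
  · have h' := Matrix.inv_smul' M (Units.mk0 c hc) h
    simpa [Units.smul_def] using h'
  · have h' : ¬ IsUnit (c • M).det := by
      rw [Matrix.det_smul]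
      simpa [isUnit_iff_ne_zero, hc] using h
    rw [Matrix.nonsing_inv_apply_not_isUnit _ h, Matrix.nonsing_inv_apply_not_isUnit _ h',
      smul_zero]

section
variable {n : ℕ} {q : ℝ}

theorem lam_inv_mul_Rmat (hq : q ≠ 0) (x y) :
    (lam n q)⁻¹ * Rmat n q x y = ((q⁻¹ * Rcore n q x y : ℝ) : ℂ) := by
  have hq' : (q : ℂ) ≠ 0 := by exact_mod_cast hq
  have : (lam n q)⁻¹ * (q : ℂ) ^ (-(1 / n : ℂ)) = (q : ℂ)⁻¹ := by
    rw [lam, ← Complex.cpow_neg, ← Complex.cpow_add _ _ hq', ← Complex.cpow_neg_one]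
    congr 1; ring
  rw [Rmat_eq, Matrix.smul_apply, smul_eq_mul, ← mul_assoc, this]
  simp

/-- The inverse of the partial transpose of `Rcore`, transposed back. -/
def RcoreTilde (n : ℕ) (q : ℝ) : Matrix (Fin n × Fin n) (Fin n × Fin n) ℝ :=
  Matrix.of fun x y =>
    (Matrix.of fun x y : Fin n × Fin n => Rcore n q (x.1, y.2) (y.1, x.2))⁻¹ (x.1, y.2) (y.1, x.2)

theorem lam_mul_Rtilde (hq : q ≠ 0) (x y) :
    lam n q * Rtilde n q x y = ((q * RcoreTilde n q x y : ℝ) : ℂ) := by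
  have hq' : (q : ℂ) ≠ 0 := by exact_mod_cast hq
  have hc : (q : ℂ) ^ (-(1 / n : ℂ)) ≠ 0 := by simp [Complex.cpow_eq_zero_iff, hq]
  have : lam n q * ((q : ℂ) ^ (-(1 / n : ℂ)))⁻¹ = (q : ℂ) := by
    rw [lam, Complex.cpow_neg, inv_inv, ← Complex.cpow_add _ _ hq']
    simp
  have h2 : transpose₂ ((Rcore n q).map (algebraMap ℝ ℂ)) =
      (Matrix.of fun x y : Fin n × Fin n => Rcore n q (x.1, y.2) (y.1, x.2)).map
        (algebraMap ℝ ℂ) := rfl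
  have h3 : ∀ M : Matrix (Fin n × Fin n) (Fin n × Fin n) ℝ,
      (M.map (algebraMap ℝ ℂ))⁻¹ = (M⁻¹).map (algebraMap ℝ ℂ) := by
    intro M
    have h4 := (algebraMap ℝ ℂ).map_adjugate M
    have h5 := (algebraMap ℝ ℂ).map_det M
    simp only [RingHom.mapMatrix_apply] at h4 h5
    ext i j
    rw [Matrix.inv_def, Matrix.inv_def, ← h4, ← h5]
    simp
  rw [Rtilde, Rmat_eq, transpose₂_smul, inv_smul_matrix _ hc, transpose₂_smul, Matrix.smul_apply,
    smul_eq_mul, ← mul_assoc, this, h2, h3]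
  simp [transpose₂, RcoreTilde]

theorem Rcore_symm (a b c d : Fin n) : Rcore n q (a, b) (c, d) = Rcore n q (d, c) (b, a) := by
  simp only [Rcore, Matrix.of_apply, Prod.mk.injEq]
  grind

theorem RcoreTilde_symm (a b c d : Fin n) :
    RcoreTilde n q (a, b) (c, d) = RcoreTilde n q (d, c) (b, a) := by
  have h := Matrix.inv_submatrix_equiv
    (Matrix.of fun x y : Fin n × Fin n => Rcore n q (x.1, y.2) (y.1, x.2))
    (Equiv.prodComm _ _) (Equiv.prodComm _ _)
  have h2 : (Matrix.of fun x y : Fin n × Fin n => Rcore n q (x.1, y.2) (y.1, x.2)).submatrix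
      (Equiv.prodComm (Fin n) (Fin n)) (Equiv.prodComm (Fin n) (Fin n)) =
      (Matrix.of fun x y : Fin n × Fin n => Rcore n q (x.1, y.2) (y.1, x.2)) := by
    ext ⟨a, b⟩ ⟨c, d⟩
    simp [Rcore_symm b c d a]
  rw [h2] at h
  have := congrFun (congrFun h (a, d)) (c, b)
  simpa [RcoreTilde] using this

end
/-! ### Quantum spheres -/

/-- Generators of the algebra `ℂ_q^n`: the vector generators `vⁱ` and the covector generators
`xᵢ`. -/
abbrev genV {n : ℕ} (i : Fin n) : FreeAlgebra ℂ (Fin n ⊕ Fin n) := FreeAlgebra.ι ℂ (Sum.inl i)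

abbrev genX {n : ℕ} (i : Fin n) : FreeAlgebra ℂ (Fin n ⊕ Fin n) := FreeAlgebra.ι ℂ (Sum.inr i)

/-- The defining relations of `ℂ_q^n`, the braided tensor product of the algebra of quantum vectors
(relations `vec`) with the algebra of quantum covectors (relations `covec`); the relation
`braid` is the exchange rule `xᵢ vʲ = ∑ vᵏ x_l λ_n R̃^{lj}_{ik}` given by the braiding. -/
inductive CqRel (n : ℕ) (q : ℝ) :
    FreeAlgebra ℂ (Fin n ⊕ Fin n) → FreeAlgebra ℂ (Fin n ⊕ Fin n) → Prop
  | vec (i j : Fin n) : CqRel n q (genV i * genV j)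
      (∑ k, ∑ l, ((lam n q)⁻¹ * Rmat n q (i, j) (k, l)) • (genV l * genV k))
  | covec (i j : Fin n) : CqRel n q (genX i * genX j)
      (∑ k, ∑ l, ((lam n q)⁻¹ * Rmat n q (k, l) (i, j)) • (genX l * genX k))
  | braid (i j : Fin n) : CqRel n q (genX i * genV j)
      (∑ k, ∑ l, (lam n q * Rtilde n q (l, j) (i, k)) • (genV k * genX l))

/-- The relations of the quantum sphere `S_q^{2n-1}`: those of `ℂ_q^n`, and the quantum norm
`∑ vᵃ g^b_a x_b` is `1`. -/
inductive SphereRel (n : ℕ) (q : ℝ) :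
    FreeAlgebra ℂ (Fin n ⊕ Fin n) → FreeAlgebra ℂ (Fin n ⊕ Fin n) → Prop
  | cq {u w : FreeAlgebra ℂ (Fin n ⊕ Fin n)} : CqRel n q u w → SphereRel n q u w
  | norm : SphereRel n q (∑ a, ∑ b, metric n q b a • (genV a * genX b)) 1

/-- The (coordinate algebra of the) quantum sphere `S_q^{2n-1}`. -/
def QSphere (n : ℕ) (q : ℝ) : Type := RingQuot (SphereRel n q)

namespace QSphere

instance (n : ℕ) (q : ℝ) : Ring (QSphere n q) := inferInstanceAs (Ring (RingQuot (SphereRel n q)))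

instance (n : ℕ) (q : ℝ) : Algebra ℂ (QSphere n q) :=
  inferInstanceAs (Algebra ℂ (RingQuot (SphereRel n q)))

variable {n : ℕ} {q : ℝ}

/-- The quotient map from the free algebra. -/
def proj (n : ℕ) (q : ℝ) : FreeAlgebra ℂ (Fin n ⊕ Fin n) →ₐ[ℂ] QSphere n q :=
  RingQuot.mkAlgHom ℂ (SphereRel n q)

/-- The generator `vⁱ` of `S_q^{2n-1}`. -/
def v (q : ℝ) (i : Fin n) : QSphere n q := proj n q (genV i)

/-- The generator `xᵢ` of `S_q^{2n-1}`. -/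
def x (q : ℝ) (i : Fin n) : QSphere n q := proj n q (genX i)

theorem proj_rel {u w : FreeAlgebra ℂ (Fin n ⊕ Fin n)} (h : SphereRel n q u w) :
    proj n q u = proj n q w := RingQuot.mkAlgHom_rel ℂ h

theorem v_mul_v (i j : Fin n) : v q i * v q j =
    ∑ k, ∑ l, ((lam n q)⁻¹ * Rmat n q (i, j) (k, l)) • (v q l * v q k) := by
  simpa [v] using proj_rel (.cq (.vec (q := q) i j))

theorem x_mul_x (i j : Fin n) : x q i * x q j =
    ∑ k, ∑ l, ((lam n q)⁻¹ * Rmat n q (k, l) (i, j)) • (x q l * x q k) := by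
  simpa [x] using proj_rel (.cq (.covec (q := q) i j))

theorem x_mul_v (i j : Fin n) : x q i * v q j =
    ∑ k, ∑ l, (lam n q * Rtilde n q (l, j) (i, k)) • (v q k * x q l) := by
  simpa [x, v] using proj_rel (.cq (.braid (q := q) i j))

theorem norm_eq : ∑ a, ∑ b, metric n q b a • (v q a * x q b) = 1 := by
  simpa [x, v] using proj_rel (SphereRel.norm (n := n) (q := q))

/-- The universal property of the quantum sphere. -/
def lift {B : Type*} [Ring B] [Algebra ℂ B] (V X : Fin n → B)
    (hv : ∀ i j, V i * V j = ∑ k, ∑ l, ((lam n q)⁻¹ * Rmat n q (i, j) (k, l)) • (V l * V k))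
    (hx : ∀ i j, X i * X j = ∑ k, ∑ l, ((lam n q)⁻¹ * Rmat n q (k, l) (i, j)) • (X l * X k))
    (hb : ∀ i j, X i * V j = ∑ k, ∑ l, (lam n q * Rtilde n q (l, j) (i, k)) • (V k * X l))
    (hn : ∑ a, ∑ b, metric n q b a • (V a * X b) = 1) : QSphere n q →ₐ[ℂ] B :=
  RingQuot.liftAlgHom ℂ ⟨FreeAlgebra.lift ℂ (Sum.elim V X), by
    intro u w h
    induction h with
    | cq h =>
      cases h with
      | vec i j => simpa using hv i j
      | covec i j => simpa using hx i j
      | braid i j => simpa using hb i j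
    | norm => simpa using hn⟩

section
variable {B : Type*} [Ring B] [Algebra ℂ B] (V X : Fin n → B)
    (hv : ∀ i j, V i * V j = ∑ k, ∑ l, ((lam n q)⁻¹ * Rmat n q (i, j) (k, l)) • (V l * V k))
    (hx : ∀ i j, X i * X j = ∑ k, ∑ l, ((lam n q)⁻¹ * Rmat n q (k, l) (i, j)) • (X l * X k))
    (hb : ∀ i j, X i * V j = ∑ k, ∑ l, (lam n q * Rtilde n q (l, j) (i, k)) • (V k * X l))
    (hn : ∑ a, ∑ b, metric n q b a • (V a * X b) = 1)

@[simp] theorem lift_v (i : Fin n) : lift V X hv hx hb hn (v q i) = V i := by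
  refine (RingQuot.liftAlgHom_mkAlgHom_apply _ _ _ _).trans ?_
  simp

@[simp] theorem lift_x (i : Fin n) : lift V X hv hx hb hn (x q i) = X i := by
  refine (RingQuot.liftAlgHom_mkAlgHom_apply _ _ _ _).trans ?_
  simp
end

theorem algHom_ext {B : Type*} [Ring B] [Algebra ℂ B] {f g : QSphere n q →ₐ[ℂ] B}
    (hv : ∀ i, f (v q i) = g (v q i)) (hx : ∀ i, f (x q i) = g (x q i)) : f = g := by
  refine RingQuot.ringQuot_ext' ℂ _ _ ?_
  ext i
  rcases i with i | i
  · exact hv i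
  · exact hx i

theorem adjoin_gens : Algebra.adjoin ℂ (Set.range (v q) ∪ Set.range (x q)) =
    (⊤ : Subalgebra ℂ (QSphere n q)) := by
  have h := adjoin_ringQuot (SphereRel n q)
  have h2 : (Set.range fun i => RingQuot.mkAlgHom ℂ (SphereRel n q) (FreeAlgebra.ι ℂ i)) =
      Set.range (v q) ∪ Set.range (x q) := by
    rw [← Set.Sum.elim_range]
    congr 1
    ext i
    rcases i with i | i <;> rfl
  rw [← h2]; exact h

variable [NeZero q]

/-- The conjugate-linear anti-endomorphism of `S_q^{2n-1}` which exchanges `vⁱ` and `xᵢ`. -/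
def starHom (n : ℕ) (q : ℝ) [NeZero q] : QSphere n q →ₐ[ℂ] ConjOp (QSphere n q) :=
  lift (fun i => ConjOp.mk (x q i)) (fun i => ConjOp.mk (v q i))
    (by
      intro i j
      apply ConjOp.out_injective
      simp only [lam_inv_mul_Rmat (NeZero.ne q), ConjOp.out_mul, ConjOp.out_mk, ConjOp.out_sum,
        ConjOp.out_smul, Complex.conj_ofReal]
      rw [x_mul_x, Finset.sum_comm]
      simp only [lam_inv_mul_Rmat (NeZero.ne q)]
      refine Finset.sum_congr rfl fun k _ => Finset.sum_congr rfl fun l _ => ?_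
      rw [Rcore_symm])
    (by
      intro i j
      apply ConjOp.out_injective
      simp only [lam_inv_mul_Rmat (NeZero.ne q), ConjOp.out_mul, ConjOp.out_mk, ConjOp.out_sum,
        ConjOp.out_smul, Complex.conj_ofReal]
      rw [v_mul_v, Finset.sum_comm]
      simp only [lam_inv_mul_Rmat (NeZero.ne q)]
      refine Finset.sum_congr rfl fun k _ => Finset.sum_congr rfl fun l _ => ?_
      rw [Rcore_symm])
    (by
      intro i j
      apply ConjOp.out_injective
      simp only [lam_mul_Rtilde (NeZero.ne q), ConjOp.out_mul, ConjOp.out_mk, ConjOp.out_sum,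
        ConjOp.out_smul, Complex.conj_ofReal]
      rw [x_mul_v, Finset.sum_comm]
      simp only [lam_mul_Rtilde (NeZero.ne q)]
      refine Finset.sum_congr rfl fun k _ => Finset.sum_congr rfl fun l _ => ?_
      rw [RcoreTilde_symm])
    (by
      apply ConjOp.out_injective
      rw [ConjOp.out_one, ← norm_eq (n := n) (q := q)]
      simp only [metric, Finset.mul_sum, lam_mul_Rtilde (NeZero.ne q), ConjOp.out_mul,
        ConjOp.out_mk, ConjOp.out_sum, ConjOp.out_smul, Complex.conj_ofReal, map_sum]
      rw [Finset.sum_comm]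
      refine Finset.sum_congr rfl fun k _ => Finset.sum_congr rfl fun l _ => ?_
      congr 1
      refine Finset.sum_congr rfl fun c _ => ?_
      rw [RcoreTilde_symm])

/-- The `⋆`-structure of the quantum sphere, determined by `xᵢ⋆ = vⁱ`. -/
instance : StarRing (QSphere n q) :=
  ConjOp.starRing (starHom n q) (algHom_ext (by simp [starHom]) (by simp [starHom]))

instance : StarModule ℂ (QSphere n q) where
  star_smul c a := by
    change (starHom n q (c • a)).out = _
    rw [map_smul, ConjOp.out_smul]; rfl

@[simp] theorem star_x (i : Fin n) : star (x q i) = v q i := by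
  change (starHom n q _).out = _
  simp [starHom]

@[simp] theorem star_v (i : Fin n) : star (v q i) = x q i := by
  change (starHom n q _).out = _
  simp [starHom]

end QSphere

/-! ### The quantum groups `SU_q(n)` -/

/-- `ε_{a₁…aₙ} = ε^{a₁…aₙ}`: it is `(-q)^{l(σ)}` if `a` is a permutation `σ`, where `l(σ)` is the
number of inversions, and `0` otherwise. -/
def qeps {n : ℕ} (q : ℝ) (a : Fin n → Fin n) : ℂ :=
  if Function.Injective a then
    (-(q : ℂ)) ^ (Finset.univ.filter fun p : Fin n × Fin n => p.1 < p.2 ∧ a p.2 < a p.1).card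
  else 0

/-- The normalisation factor `ν_n` of the quantum determinant. -/
def qnu (n : ℕ) (q : ℝ) : ℂ := ∑ a : Fin n → Fin n, qeps q a * qeps q (fun k => a k.rev)

/-- The quantum determinant of a matrix with entries in a complex algebra. -/
def qdet {n : ℕ} (q : ℝ) {B : Type*} [Ring B] [Algebra ℂ B] (t : Fin n → Fin n → B) : B :=
  (qnu n q)⁻¹ • ∑ a : Fin n → Fin n, ∑ b : Fin n → Fin n,
    (qeps q a * qeps q (fun k => b k.rev)) • (List.ofFn fun k => t (a k) (b k)).prod

/-- The generator `tⁱ_j` of the free algebra. -/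
abbrev genT {n : ℕ} (i j : Fin n) : FreeAlgebra ℂ (Fin n × Fin n) := FreeAlgebra.ι ℂ (i, j)

/-- The relations of `SU_q(n)`: the relations `R t₁ t₂ = t₂ t₁ R` of `A(R_n)`, and
`det_{q,n} = 1`. -/
inductive SUqRel (n : ℕ) (q : ℝ) :
    FreeAlgebra ℂ (Fin n × Fin n) → FreeAlgebra ℂ (Fin n × Fin n) → Prop
  | rtt (i j m p : Fin n) : SUqRel n q
      (∑ k, ∑ l, Rmat n q (i, j) (k, l) • (genT k m * genT l p))
      (∑ k, ∑ l, Rmat n q (k, l) (m, p) • (genT j l * genT i k))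
  | det : SUqRel n q (qdet q genT) 1

/-- The (coordinate algebra of the) quantum group `SU_q(n)`. -/
def SUq (n : ℕ) (q : ℝ) : Type := RingQuot (SUqRel n q)

namespace SUq

instance (n : ℕ) (q : ℝ) : Ring (SUq n q) := inferInstanceAs (Ring (RingQuot (SUqRel n q)))

instance (n : ℕ) (q : ℝ) : Algebra ℂ (SUq n q) :=
  inferInstanceAs (Algebra ℂ (RingQuot (SUqRel n q)))

/-- The quotient map from the free algebra. -/
def proj (n : ℕ) (q : ℝ) : FreeAlgebra ℂ (Fin n × Fin n) →ₐ[ℂ] SUq n q :=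
  RingQuot.mkAlgHom ℂ (SUqRel n q)

/-- The generator `tⁱ_j` of `SU_q(n)`. -/
def t {n : ℕ} (q : ℝ) (i j : Fin n) : SUq n q := proj n q (genT i j)

theorem proj_rel {n : ℕ} {q : ℝ} {u w : FreeAlgebra ℂ (Fin n × Fin n)} (h : SUqRel n q u w) :
    proj n q u = proj n q w := RingQuot.mkAlgHom_rel ℂ h

theorem map_qdet {n : ℕ} {q : ℝ} {B C : Type*} [Ring B] [Algebra ℂ B] [Ring C] [Algebra ℂ C]
    (f : B →ₐ[ℂ] C) (T : Fin n → Fin n → B) : f (qdet q T) = qdet q fun i j => f (T i j) := by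
  simp [qdet, map_list_prod, List.map_ofFn, Function.comp_def]

theorem t_rtt {n : ℕ} {q : ℝ} (i j m p : Fin n) :
    ∑ k, ∑ l, Rmat n q (i, j) (k, l) • (t q k m * t q l p) =
      ∑ k, ∑ l, Rmat n q (k, l) (m, p) • (t q j l * t q i k) := by
  simpa [t] using proj_rel (SUqRel.rtt (q := q) i j m p)

theorem t_det {n : ℕ} {q : ℝ} : qdet q (t (n := n) q) = 1 := by
  have h := proj_rel (SUqRel.det (n := n) (q := q))
  rw [map_qdet, map_one] at h
  exact h

theorem algHom_ext {n : ℕ} {q : ℝ} {B : Type*} [Ring B] [Algebra ℂ B] {f g : SUq n q →ₐ[ℂ] B}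
    (h : ∀ i j, f (t q i j) = g (t q i j)) : f = g := by
  refine RingQuot.ringQuot_ext' ℂ _ _ ?_
  ext ⟨i, j⟩
  exact h i j

theorem adjoin_gens {n : ℕ} {q : ℝ} :
    Algebra.adjoin ℂ (Set.range fun p : Fin n × Fin n => t q p.1 p.2) = ⊤ :=
  adjoin_ringQuot (SUqRel n q)

/-! #### The case `n = 2` -/

/-- The relations of `SU_q(2)` for a matrix with rows `(a, b)` and `(c, d)`. -/
structure IsQMat (q : ℝ) {B : Type*} [Ring B] [Algebra ℂ B] (a b c d : B) : Prop where
  ba : b * a = (q : ℂ) • (a * b)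
  ca : c * a = (q : ℂ) • (a * c)
  cb : c * b = b * c
  db : d * b = (q : ℂ) • (b * d)
  dc : d * c = (q : ℂ) • (c * d)
  ad : a * d = 1 + (q : ℂ)⁻¹ • (b * c)
  da : d * a = 1 + (q : ℂ) • (b * c)

theorem Rmat_two {q : ℝ} (i j k l : Fin 2) : Rmat 2 q (i, j) (k, l) =
    (q : ℂ) ^ (-(1 / 2 : ℂ)) * (if i = k ∧ j = l then (if i = j then (q : ℂ) else 1)
    else if i = l ∧ j = k ∧ i < j then (q : ℂ) - (q : ℂ)⁻¹ else 0) := by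
  rw [Rmat_eq]
  simp only [Matrix.smul_apply, Matrix.map_apply, Rcore, Matrix.of_apply, smul_eq_mul,
    Prod.mk.injEq, Nat.cast_ofNat]
  congr 1
  split_ifs <;> simp

theorem sum_fin_two_fun {M : Type*} [AddCommMonoid M] (f : (Fin 2 → Fin 2) → M) :
    ∑ a, f a = f ![0, 0] + f ![0, 1] + (f ![1, 0] + f ![1, 1]) := by
  rw [← (finTwoArrowEquiv (Fin 2)).symm.sum_comp, Fintype.sum_prod_type]
  simp [Fin.sum_univ_two, finTwoArrowEquiv]

theorem qeps_two {q : ℝ} : qeps q ![(0 : Fin 2), 0] = 0 ∧ qeps q ![(0 : Fin 2), 1] = 1 ∧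
    qeps q ![(1 : Fin 2), 0] = -q ∧ qeps q ![(1 : Fin 2), 1] = 0 := by
  have h1 : ¬ Function.Injective ![(0 : Fin 2), 0] := by decide
  have h2 : Function.Injective ![(0 : Fin 2), 1] := by decide
  have h3 : Function.Injective ![(1 : Fin 2), 0] := by decide
  have h4 : ¬ Function.Injective ![(1 : Fin 2), 1] := by decide
  have h5 : (Finset.univ.filter fun p : Fin 2 × Fin 2 =>
    p.1 < p.2 ∧ ![(0 : Fin 2), 1] p.2 < ![(0 : Fin 2), 1] p.1).card = 0 := by decide
  have h6 : (Finset.univ.filter fun p : Fin 2 × Fin 2 =>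
    p.1 < p.2 ∧ ![(1 : Fin 2), 0] p.2 < ![(1 : Fin 2), 0] p.1).card = 1 := by decide
  refine ⟨?_, ?_, ?_, ?_⟩ <;> unfold qeps
  · rw [if_neg h1]
  · rw [if_pos h2, h5, pow_zero]
  · rw [if_pos h3, h6, pow_one]
  · rw [if_neg h4]

theorem rev_two (a b : Fin 2) : (fun k : Fin 2 => ![a, b] k.rev) = ![b, a] := by
  ext k; fin_cases k <;> rfl

theorem qdet_two {q : ℝ} (hq : q ≠ 0) {B : Type*} [Ring B] [Algebra ℂ B]
    (T : Fin 2 → Fin 2 → B) : qdet q T = (2⁻¹ : ℂ) • (T 0 0 * T 1 1 - (q : ℂ)⁻¹ • (T 0 1 * T 1 0)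
      - (q : ℂ) • (T 1 0 * T 0 1) + T 1 1 * T 0 0) := by
  have hq' : (q : ℂ) ≠ 0 := by exact_mod_cast hq
  obtain ⟨h1, h2, h3, h4⟩ := qeps_two (q := q)
  simp only [qdet, qnu, sum_fin_two_fun, rev_two, h1, h2, h3, h4, List.ofFn_succ, List.ofFn_zero,
    List.prod_cons, List.prod_nil, mul_one]
  clear h1 h2 h3 h4
  generalize (q : ℂ) = k at *
  simp
  match_scalars <;> grind

theorem isQMat_iff {q : ℝ} (hq : q ≠ 0) {B : Type*} [Ring B] [Algebra ℂ B]
    (T : Fin 2 → Fin 2 → B) : IsQMat q (T 0 0) (T 0 1) (T 1 0) (T 1 1) ↔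
      (∀ i j m p, ∑ k, ∑ l, Rmat 2 q (i, j) (k, l) • (T k m * T l p) =
        ∑ k, ∑ l, Rmat 2 q (k, l) (m, p) • (T j l * T i k)) ∧ qdet q T = 1 := by
  have hq' : (q : ℂ) ≠ 0 := by exact_mod_cast hq
  have hc : (q : ℂ) ^ (-(1 / 2 : ℂ)) ≠ 0 := by simp [Complex.cpow_eq_zero_iff, hq]
  simp only [Rmat_two, mul_smul, ← Finset.smul_sum, smul_right_inj hc]
  rw [qdet_two hq]
  constructor
  · rintro ⟨ba, ca, cb, db, dc, ad, da⟩
    clear hc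
    generalize (q : ℂ) = k at *
    refine ⟨?_, ?_⟩
    · intro i j m p
      fin_cases i <;> fin_cases j <;> fin_cases m <;> fin_cases p <;>
        simp [Fin.sum_univ_two, ba, ca, cb, db, dc, ad, da] <;>
        match_scalars <;> grind
    · rw [cb, ad, da]
      match_scalars <;> grind
  · rintro ⟨h, hd⟩
    have e1 := h 0 0 0 1
    have e2 := h 1 0 0 0
    have e3 := h 0 1 0 1
    have e3' := h 0 1 1 0
    have e4 := h 1 1 0 1
    have e5 := h 1 0 1 1
    clear h hc
    generalize hk : (q : ℂ) = k at *
    simp [Fin.sum_univ_two] at e1 e2 e3 e3' e4 e5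
    have ecb : T 1 0 * T 0 1 = T 0 1 * T 1 0 := by
      rw [add_comm] at e3'
      exact (add_left_cancel e3').symm
    rw [ecb] at e3 hd
    refine ⟨?_, ?_, ?_, ?_, ?_, ?_, ?_⟩ <;> try rw [hk]
    · exact e1.symm
    · exact e2
    · exact ecb
    · exact e5
    · exact e4.symm
    · rw [← e3] at hd
      rw [← hd]
      match_scalars <;> grind
    · rw [← e3] at hd ⊢
      rw [← hd]
      match_scalars <;> grind

end SUq
set_option linter.unusedSimpArgs false

namespace SUq
variable {q : ℝ} [NeZero q]

theorem isQMat_t : IsQMat q (t (n := 2) q 0 0) (t q 0 1) (t q 1 0) (t q 1 1) :=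
  (isQMat_iff (NeZero.ne q) (t (n := 2) q)).2 ⟨t_rtt, t_det⟩

/-- The universal property of `SU_q(2)`. -/
def lift {B : Type*} [Ring B] [Algebra ℂ B] (T : Fin 2 → Fin 2 → B)
    (h : IsQMat q (T 0 0) (T 0 1) (T 1 0) (T 1 1)) : SUq 2 q →ₐ[ℂ] B :=
  RingQuot.liftAlgHom ℂ ⟨FreeAlgebra.lift ℂ (fun p => T p.1 p.2), by
    obtain ⟨h1, h2⟩ := (isQMat_iff (NeZero.ne q) T).1 h
    intro u w hr
    induction hr with
    | rtt i j m p => simpa using h1 i j m p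
    | det => rw [map_qdet, map_one]; simpa using h2⟩

@[simp] theorem lift_t {B : Type*} [Ring B] [Algebra ℂ B] (T : Fin 2 → Fin 2 → B)
    (h : IsQMat q (T 0 0) (T 0 1) (T 1 0) (T 1 1)) (i j : Fin 2) : lift T h (t q i j) = T i j := by
  refine (RingQuot.liftAlgHom_mkAlgHom_apply _ _ _ _).trans ?_
  simp

/-- The comultiplication `tⁱ_j ↦ ∑ tⁱ_k ⊗ tᵏ_j`. -/
def comulHom (q : ℝ) [NeZero q] : SUq 2 q →ₐ[ℂ] SUq 2 q ⊗[ℂ] SUq 2 q :=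
  lift (fun i j => ∑ k, t q i k ⊗ₜ[ℂ] t q k j) (by
    obtain ⟨ba, ca, cb, db, dc, ad, da⟩ := isQMat_t (q := q)
    have hq' : (q : ℂ) ≠ 0 := by exact_mod_cast NeZero.ne q
    simp only [Fin.sum_univ_two]
    generalize t (n := 2) q 0 0 = a at *
    generalize t (n := 2) q 0 1 = b at *
    generalize t (n := 2) q 1 0 = c at *
    generalize t (n := 2) q 1 1 = d at *
    constructor
    all_goals
      generalize (q : ℂ) = k at *
      simp only [add_mul, mul_add, Algebra.TensorProduct.tmul_mul_tmul, ba, ca, cb, db, dc, ad, da,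
        TensorProduct.tmul_add, TensorProduct.add_tmul, TensorProduct.tmul_smul,
        ← TensorProduct.smul_tmul', smul_add, smul_smul, Algebra.TensorProduct.one_def]
      match_scalars <;> grind)

/-- The counit `tⁱ_j ↦ δⁱ_j`. -/
def counitHom (q : ℝ) [NeZero q] : SUq 2 q →ₐ[ℂ] ℂ :=
  lift (fun i j => if i = j then 1 else 0) (by constructor <;> simp)

instance : Bialgebra ℂ (SUq 2 q) :=
  Bialgebra.ofAlgHom (comulHom q) (counitHom q)
    (algHom_ext fun i j => by
      fin_cases i <;> fin_cases j <;>
      simp [comulHom, Fin.sum_univ_two, TensorProduct.tmul_add, TensorProduct.add_tmul] <;> abel)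
    (algHom_ext fun i j => by
      fin_cases i <;> fin_cases j <;>
      simp [comulHom, counitHom, Fin.sum_univ_two])
    (algHom_ext fun i j => by
      fin_cases i <;> fin_cases j <;>
      simp [comulHom, counitHom, Fin.sum_univ_two])

@[simp] theorem comul_t (i j : Fin 2) :
    Coalgebra.comul (R := ℂ) (t q i j) = ∑ k, t q i k ⊗ₜ[ℂ] t q k j := by
  change comulHom q (t q i j) = _
  simp [comulHom]

@[simp] theorem counit_t (i j : Fin 2) :
    Coalgebra.counit (R := ℂ) (t q i j) = if i = j then 1 else 0 := by
  change counitHom q (t q i j) = _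
  simp [counitHom]

/-- The matrix `S tⁱ_j` of antipodes of the generators of `SU_q(2)`. -/
def antipodeMat (q : ℝ) (i j : Fin 2) : SUq 2 q :=
  !![t q 1 1, -((q : ℂ) • t q 0 1); -((q : ℂ)⁻¹ • t q 1 0), t q 0 0] i j

/-- The antipode of `SU_q(2)` as an algebra homomorphism to the opposite algebra. -/
def antipodeHom (q : ℝ) [NeZero q] : SUq 2 q →ₐ[ℂ] (SUq 2 q)ᵐᵒᵖ :=
  lift (fun i j => MulOpposite.op (antipodeMat q i j)) (by
    obtain ⟨ba, ca, cb, db, dc, ad, da⟩ := isQMat_t (q := q)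
    have hq' : (q : ℂ) ≠ 0 := by exact_mod_cast NeZero.ne q
    simp only [antipodeMat, Matrix.of_apply, Matrix.cons_val', Matrix.cons_val_zero,
      Matrix.cons_val_one, Matrix.cons_val_fin_one]
    constructor
    all_goals
      apply MulOpposite.unop_injective
      simp [-Complex.coe_smul, ba, ca, cb, db, dc, ad, da, smul_smul, hq'])

theorem unop_antipodeHom_t (i j : Fin 2) :
    (antipodeHom q (t q i j)).unop = antipodeMat q i j := by simp [antipodeHom]

instance : HopfAlgebra ℂ (SUq 2 q) :=
  hopfOfGenerators (antipodeHom q) _ adjoin_gens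
    (by
      obtain ⟨ba, ca, cb, db, dc, ad, da⟩ := isQMat_t (q := q)
      have hq' : (q : ℂ) ≠ 0 := by exact_mod_cast NeZero.ne q
      rintro _ ⟨⟨i, j⟩, rfl⟩
      simp only [comul_t, counit_t, Fin.sum_univ_two]
      fin_cases i <;> fin_cases j <;>
        simp [-Complex.coe_smul, unop_antipodeHom_t, antipodeMat, ba, ca, cb, db, dc, ad, da, smul_smul, hq'])
    (by
      obtain ⟨ba, ca, cb, db, dc, ad, da⟩ := isQMat_t (q := q)
      have hq' : (q : ℂ) ≠ 0 := by exact_mod_cast NeZero.ne q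
      rintro _ ⟨⟨i, j⟩, rfl⟩
      simp only [comul_t, counit_t, Fin.sum_univ_two]
      fin_cases i <;> fin_cases j <;>
        simp [-Complex.coe_smul, unop_antipodeHom_t, antipodeMat, ba, ca, cb, db, dc, ad, da, smul_smul, hq'])

theorem antipode_t (i j : Fin 2) :
    HopfAlgebra.antipode ℂ (t q i j) = antipodeMat q i j := unop_antipodeHom_t i j

/-- The conjugate-linear anti-endomorphism of `SU_q(2)` with `tᵃ_b ↦ S tᵇ_a`. -/
def starHom (q : ℝ) [NeZero q] : SUq 2 q →ₐ[ℂ] ConjOp (SUq 2 q) :=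
  lift (fun a b => ConjOp.mk (HopfAlgebra.antipode ℂ (t q b a))) (by
    obtain ⟨ba, ca, cb, db, dc, ad, da⟩ := isQMat_t (q := q)
    have hq' : (q : ℂ) ≠ 0 := by exact_mod_cast NeZero.ne q
    simp only [antipode_t, antipodeMat, Matrix.of_apply, Matrix.cons_val', Matrix.cons_val_zero,
      Matrix.cons_val_one, Matrix.cons_val_fin_one]
    constructor
    all_goals
      apply ConjOp.out_injective
      simp [-Complex.coe_smul, ba, ca, cb, db, dc, ad, da, smul_smul, hq'])

/-- The `⋆`-structure of `SU_q(2)`, determined by `(tᵃ_b)⋆ = S tᵇ_a`. -/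
instance : StarRing (SUq 2 q) :=
  ConjOp.starRing (starHom q) (algHom_ext fun i j => by
    have hq' : (q : ℂ) ≠ 0 := by exact_mod_cast NeZero.ne q
    fin_cases i <;> fin_cases j <;>
      simp [-Complex.coe_smul, starHom, antipode_t, antipodeMat, smul_smul, hq'])

instance : StarModule ℂ (SUq 2 q) where
  star_smul c a := by
    change (starHom q (c • a)).out = _
    rw [map_smul, ConjOp.out_smul]; rfl

@[simp] theorem star_t (a b : Fin 2) : star (t q a b) = HopfAlgebra.antipode ℂ (t q b a) := by
  change (starHom q _).out = _
  simp [starHom]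

end SUq
/-! ### The circle `U_q(1)` and the quantum 1-sphere -/

/-- The `⋆`-structure of `U_q(1)`, the algebra `ℂ[z, z⁻¹]` of Laurent polynomials (with its
Mathlib Hopf algebra structure, in which `z` is group-like): conjugate-linear with `z⋆ = z⁻¹`. -/
instance : StarRing ℂ[T;T⁻¹] where
  star f := LaurentPolynomial.invert (AddMonoidAlgebra.mapRingHom ℤ (starRingEnd ℂ) f)
  star_involutive f := by
    change LaurentPolynomial.invert (AddMonoidAlgebra.mapRingHom ℤ (starRingEnd ℂ)
      (LaurentPolynomial.invert (AddMonoidAlgebra.mapRingHom ℤ (starRingEnd ℂ) f))) = f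
    induction f using LaurentPolynomial.induction_on' with
    | add p q hp hq => simp only [map_add, hp, hq]
    | C_mul_T n a =>
      simp [← LaurentPolynomial.single_eq_C_mul_T, LaurentPolynomial.invert]
  star_mul f g := by simp [mul_comm]
  star_add f g := by simp

theorem laurent_star_apply (f : ℂ[T;T⁻¹]) : star f =
    LaurentPolynomial.invert (AddMonoidAlgebra.mapRingHom ℤ (starRingEnd ℂ) f) := rfl

@[simp] theorem laurent_star_T (n : ℤ) :
    star (LaurentPolynomial.T n : ℂ[T;T⁻¹]) = LaurentPolynomial.T (-n) := by
  rw [laurent_star_apply, ← LaurentPolynomial.invert_T]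
  simp [LaurentPolynomial.T, -LaurentPolynomial.single_eq_C_mul_T]

instance : StarModule ℂ ℂ[T;T⁻¹] where
  star_smul c f := by
    rw [LaurentPolynomial.smul_eq_C_mul, star_mul, mul_comm, LaurentPolynomial.smul_eq_C_mul]
    congr 1
    rw [laurent_star_apply, ← LaurentPolynomial.single_eq_C, ← LaurentPolynomial.single_eq_C]
    simp [LaurentPolynomial.invert,
      -LaurentPolynomial.single_eq_C_mul_T]

namespace QSphere
variable {q : ℝ} [NeZero q]

theorem lam_inv_mul_Rmat_one (x y) : (lam 1 q)⁻¹ * Rmat 1 q x y = 1 := by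
  have hq := NeZero.ne q
  rw [lam_inv_mul_Rmat hq, Subsingleton.elim x y, Subsingleton.elim y (0, 0)]
  simp [Rcore, hq]

theorem lam_mul_Rtilde_one (x y) : lam 1 q * Rtilde 1 q x y = 1 := by
  have hq := NeZero.ne q
  rw [lam_mul_Rtilde hq, Subsingleton.elim x y, Subsingleton.elim y (0, 0)]
  simp [RcoreTilde, Matrix.inv_subsingleton, Rcore, hq]

/-- The universal property of `S_q^1`. -/
def lift₁ {B : Type*} [Ring B] [Algebra ℂ B] (V X : B) (hXV : X * V = 1) (hVX : V * X = 1) :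
    QSphere 1 q →ₐ[ℂ] B :=
  lift (fun _ => V) (fun _ => X) (by simp [lam_inv_mul_Rmat_one])
    (by simp [lam_inv_mul_Rmat_one]) (by simp [lam_mul_Rtilde_one, hXV, hVX])
    (by simp [metric, lam_mul_Rtilde_one, hVX])

@[simp] theorem lift₁_v {B : Type*} [Ring B] [Algebra ℂ B] (V X : B) (h h') (i : Fin 1) :
    lift₁ V X h h' (v q i) = V := by simp [lift₁]

@[simp] theorem lift₁_x {B : Type*} [Ring B] [Algebra ℂ B] (V X : B) (h h') (i : Fin 1) :
    lift₁ V X h h' (x q i) = X := by simp [lift₁]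

theorem v_mul_x_one (i j : Fin 1) : v q i * x q j = 1 := by
  have h := norm_eq (n := 1) (q := q)
  rw [Subsingleton.elim i 0, Subsingleton.elim j 0]
  simpa [metric, lam_mul_Rtilde_one] using h

theorem x_mul_v_one (i j : Fin 1) : x q i * v q j = 1 := by
  rw [x_mul_v]
  simp [lam_mul_Rtilde_one, v_mul_x_one]

/-- The bialgebra structure of `S_q^1` in which the generator `x` is group-like. -/
instance : Bialgebra ℂ (QSphere 1 q) :=
  Bialgebra.ofAlgHom
    (lift₁ (v q 0 ⊗ₜ[ℂ] v q 0) (x q 0 ⊗ₜ[ℂ] x q 0)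
      (by simp [x_mul_v_one, Algebra.TensorProduct.one_def])
      (by simp [v_mul_x_one, Algebra.TensorProduct.one_def]))
    (lift₁ 1 1 (by simp) (by simp))
    (algHom_ext (fun i => by simp) (fun i => by simp))
    (algHom_ext (fun i => by simp [Subsingleton.elim i 0]) (fun i => by
      simp [Subsingleton.elim i 0]))
    (algHom_ext (fun i => by simp [Subsingleton.elim i 0]) (fun i => by
      simp [Subsingleton.elim i 0]))

@[simp] theorem comul_x (i : Fin 1) :
    Coalgebra.comul (R := ℂ) (x q i) = x q i ⊗ₜ[ℂ] x q i := by
  rw [Subsingleton.elim i 0]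
  exact lift₁_x _ _ _ _ _

@[simp] theorem comul_v (i : Fin 1) :
    Coalgebra.comul (R := ℂ) (v q i) = v q i ⊗ₜ[ℂ] v q i := by
  rw [Subsingleton.elim i 0]
  exact lift₁_v _ _ _ _ _

@[simp] theorem counit_x (i : Fin 1) : Coalgebra.counit (R := ℂ) (x q i) = 1 :=
  lift₁_x _ _ _ _ _

@[simp] theorem counit_v (i : Fin 1) : Coalgebra.counit (R := ℂ) (v q i) = 1 :=
  lift₁_v _ _ _ _ _

/-- The Hopf algebra structure of the quantum group `S_q^1`: `Δ x = x ⊗ x`, `ε x = 1` and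
`S x = x⋆`. -/
instance : HopfAlgebra ℂ (QSphere 1 q) :=
  hopfOfGenerators
    (lift₁ (MulOpposite.op (x q 0)) (MulOpposite.op (v q 0))
      (MulOpposite.unop_injective (by simp [x_mul_v_one]))
      (MulOpposite.unop_injective (by simp [v_mul_x_one]))) _ adjoin_gens
    (by rintro _ (⟨i, rfl⟩ | ⟨i, rfl⟩) <;> simp [x_mul_v_one, v_mul_x_one])
    (by rintro _ (⟨i, rfl⟩ | ⟨i, rfl⟩) <;> simp [x_mul_v_one, v_mul_x_one])

end QSphere

/-! ### The Podleś sphere -/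

/-- The generators of the Podleś sphere. -/
inductive PodlesGen
  | A
  | B
  | Bstar

/-- The relations of the standard Podleś sphere `S_q^2`:
`B⋆ B = A - A²`, `B B⋆ = q² A - q⁴ A²`, `B A = q² A B`, `A B⋆ = q² B⋆ A` (and `A⋆ = A`). -/
inductive PodlesRel (q : ℝ) : FreeAlgebra ℂ PodlesGen → FreeAlgebra ℂ PodlesGen → Prop
  | BstarB : PodlesRel q (FreeAlgebra.ι ℂ .Bstar * FreeAlgebra.ι ℂ .B)
      (FreeAlgebra.ι ℂ .A - FreeAlgebra.ι ℂ .A ^ 2)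
  | BBstar : PodlesRel q (FreeAlgebra.ι ℂ .B * FreeAlgebra.ι ℂ .Bstar)
      ((q : ℂ) ^ 2 • FreeAlgebra.ι ℂ .A - (q : ℂ) ^ 4 • FreeAlgebra.ι ℂ .A ^ 2)
  | BA : PodlesRel q (FreeAlgebra.ι ℂ .B * FreeAlgebra.ι ℂ .A)
      ((q : ℂ) ^ 2 • (FreeAlgebra.ι ℂ .A * FreeAlgebra.ι ℂ .B))
  | ABstar : PodlesRel q (FreeAlgebra.ι ℂ .A * FreeAlgebra.ι ℂ .Bstar)
      ((q : ℂ) ^ 2 • (FreeAlgebra.ι ℂ .Bstar * FreeAlgebra.ι ℂ .A))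

/-- The (coordinate algebra of the) standard Podleś sphere `S_q^2`. -/
def Podles (q : ℝ) : Type := RingQuot (PodlesRel q)

namespace Podles
variable {q : ℝ}

instance (q : ℝ) : Ring (Podles q) := inferInstanceAs (Ring (RingQuot (PodlesRel q)))

instance (q : ℝ) : Algebra ℂ (Podles q) := inferInstanceAs (Algebra ℂ (RingQuot (PodlesRel q)))

/-- The quotient map from the free algebra. -/
def proj (q : ℝ) : FreeAlgebra ℂ PodlesGen →ₐ[ℂ] Podles q := RingQuot.mkAlgHom ℂ (PodlesRel q)

/-- The image of a generator in the Podleś sphere. -/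
def gen (q : ℝ) (g : PodlesGen) : Podles q := proj q (FreeAlgebra.ι ℂ g)

theorem proj_rel {u w : FreeAlgebra ℂ PodlesGen} (h : PodlesRel q u w) :
    proj q u = proj q w := RingQuot.mkAlgHom_rel ℂ h

theorem Bstar_mul_B : gen q .Bstar * gen q .B = gen q .A - gen q .A ^ 2 := by
  simpa only [gen, map_mul, map_sub, map_pow] using proj_rel (PodlesRel.BstarB (q := q))

theorem B_mul_Bstar : gen q .B * gen q .Bstar =
    (q : ℂ) ^ 2 • gen q .A - (q : ℂ) ^ 4 • gen q .A ^ 2 := by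
  simpa only [gen, map_mul, map_sub, map_pow, map_smul] using proj_rel (PodlesRel.BBstar (q := q))

theorem B_mul_A : gen q .B * gen q .A = (q : ℂ) ^ 2 • (gen q .A * gen q .B) := by
  simpa only [gen, map_mul, map_smul] using proj_rel (PodlesRel.BA (q := q))

theorem A_mul_Bstar : gen q .A * gen q .Bstar = (q : ℂ) ^ 2 • (gen q .Bstar * gen q .A) := by
  simpa only [gen, map_mul, map_smul] using proj_rel (PodlesRel.ABstar (q := q))

/-- The universal property of the Podleś sphere. -/
def lift {C : Type*} [Ring C] [Algebra ℂ C] (f : PodlesGen → C)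
    (h₁ : f .Bstar * f .B = f .A - f .A ^ 2)
    (h₂ : f .B * f .Bstar = (q : ℂ) ^ 2 • f .A - (q : ℂ) ^ 4 • f .A ^ 2)
    (h₃ : f .B * f .A = (q : ℂ) ^ 2 • (f .A * f .B))
    (h₄ : f .A * f .Bstar = (q : ℂ) ^ 2 • (f .Bstar * f .A)) : Podles q →ₐ[ℂ] C :=
  RingQuot.liftAlgHom ℂ ⟨FreeAlgebra.lift ℂ f, by
    intro u w h
    cases h <;> simpa only [map_mul, map_sub, map_pow, map_smul, FreeAlgebra.lift_ι_apply]⟩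

@[simp] theorem lift_gen {C : Type*} [Ring C] [Algebra ℂ C] (f : PodlesGen → C) (h₁ h₂ h₃ h₄)
    (g : PodlesGen) : lift (q := q) f h₁ h₂ h₃ h₄ (gen q g) = f g := by
  refine (RingQuot.liftAlgHom_mkAlgHom_apply _ _ _ _).trans ?_
  simp

theorem algHom_ext {C : Type*} [Ring C] [Algebra ℂ C] {f g : Podles q →ₐ[ℂ] C}
    (h : ∀ i, f (gen q i) = g (gen q i)) : f = g := by
  refine RingQuot.ringQuot_ext' ℂ _ _ ?_
  ext i
  exact h i

/-- The involution on generators. -/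
def genStar : PodlesGen → PodlesGen
  | .A => .A
  | .B => .Bstar
  | .Bstar => .B

/-- The conjugate-linear anti-endomorphism given by `A ↦ A`, `B ↦ B⋆`, `B⋆ ↦ B`. -/
def starHom (q : ℝ) : Podles q →ₐ[ℂ] ConjOp (Podles q) :=
  lift (fun g => ConjOp.mk (gen q (genStar g)))
    (ConjOp.out_injective (by simpa [genStar, pow_two] using Bstar_mul_B))
    (ConjOp.out_injective (by
      simpa [-Complex.coe_smul, genStar, pow_two] using B_mul_Bstar (q := q)))
    (ConjOp.out_injective (by simpa [-Complex.coe_smul, genStar] using A_mul_Bstar (q := q)))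
    (ConjOp.out_injective (by simpa [-Complex.coe_smul, genStar] using B_mul_A (q := q)))

/-- The `⋆`-structure of the Podleś sphere, with `A⋆ = A` and `(B)⋆ = B⋆`. -/
instance : StarRing (Podles q) :=
  ConjOp.starRing (starHom q) (algHom_ext fun i => by cases i <;> simp [starHom, genStar])

instance : StarModule ℂ (Podles q) where
  star_smul c a := by
    change (starHom q (c • a)).out = _
    rw [map_smul, ConjOp.out_smul]; rfl

@[simp] theorem star_gen (g : PodlesGen) : star (gen q g) = gen q (genStar g) := by
  change (starHom q _).out = _
  simp [starHom]

end Podles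

/-! ### Quantum principal bundles -/

section bundle
variable {A P : Type*} [Ring A] [HopfAlgebra ℂ A] [Ring P]

/-- `P` is a left `A`-comodule algebra with coaction `β`. -/
structure IsLeftComoduleAlgebra [Algebra ℂ P] (β : P →ₐ[ℂ] A ⊗[ℂ] P) : Prop where
  coassoc : ∀ u, (TensorProduct.assoc ℂ A A P) ((Coalgebra.comul (R := ℂ)).rTensor P (β u)) =
    β.toLinearMap.lTensor A (β u)
  counit : ∀ u, TensorProduct.lid ℂ P ((Coalgebra.counit (R := ℂ)).rTensor P (β u)) = u

/-- The subalgebra `P^A = {u | β u = 1 ⊗ u}` of invariant elements. -/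
def invariants [Algebra ℂ P] (β : P →ₐ[ℂ] A ⊗[ℂ] P) : Subalgebra ℂ P :=
  AlgHom.equalizer β Algebra.TensorProduct.includeRight

theorem mem_invariants [Algebra ℂ P] (β : P →ₐ[ℂ] A ⊗[ℂ] P) (u : P) :
    u ∈ invariants β ↔ β u = 1 ⊗ₜ[ℂ] u := Iff.rfl

/-- The canonical map `P ⊗ P → A ⊗ P`, `u ⊗ w ↦ β u (1 ⊗ w)`. -/
def canonicalMap [Algebra ℂ P] (β : P →ₐ[ℂ] A ⊗[ℂ] P) : P ⊗[ℂ] P →ₗ[ℂ] A ⊗[ℂ] P :=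
  LinearMap.mul' ℂ (A ⊗[ℂ] P) ∘ₗ TensorProduct.map β.toLinearMap
    (Algebra.TensorProduct.includeRight : P →ₐ[ℂ] A ⊗[ℂ] P).toLinearMap

theorem canonicalMap_tmul [Algebra ℂ P] (β : P →ₐ[ℂ] A ⊗[ℂ] P) (u w : P) :
    canonicalMap β (u ⊗ₜ[ℂ] w) = β u * 1 ⊗ₜ[ℂ] w := by simp [canonicalMap]

/-- The universal 1-forms `Ω¹P = ker (P ⊗ P → P)`, with differential `d u = 1 ⊗ u - u ⊗ 1`. -/
def universalForms (P : Type*) [Ring P] [Algebra ℂ P] : Submodule ℂ (P ⊗[ℂ] P) :=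
  LinearMap.ker (LinearMap.mul' ℂ P)

/-- The horizontal 1-forms `P (dB) P` over a subalgebra `B`. -/
def horizontalForms [Algebra ℂ P] (B : Subalgebra ℂ P) : Submodule ℂ (P ⊗[ℂ] P) :=
  Submodule.span ℂ {ω | ∃ u w : P, ∃ b ∈ B,
    ω = u ⊗ₜ[ℂ] 1 * (1 ⊗ₜ[ℂ] b - b ⊗ₜ[ℂ] 1) * 1 ⊗ₜ[ℂ] w}

/-- `P` is a quantum principal bundle (with the universal differential calculus) with structure
quantum group `A`, coaction `β` and base `P^A`. -/
structure IsQuantumPrincipalBundle [Algebra ℂ P] (β : P →ₐ[ℂ] A ⊗[ℂ] P) : Prop where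
  comoduleAlgebra : IsLeftComoduleAlgebra β
  free : Function.Surjective (canonicalMap β)
  exact : ∀ ω ∈ universalForms P, canonicalMap β ω = 0 ↔ ω ∈ horizontalForms (invariants β)

/-- The left coaction `(π ⊗ id) ∘ Δ` of `A` on `P` given by a bialgebra map `π : P → A`. -/
def homogeneousCoaction [HopfAlgebra ℂ P] (π : P →ₐc[ℂ] A) : P →ₐ[ℂ] A ⊗[ℂ] P :=
  (Algebra.TensorProduct.map (π : P →ₐ[ℂ] A) (AlgHom.id ℂ P)).comp (Bialgebra.comulAlgHom ℂ P)

/-- Exactness of a Hopf algebra map `π : P → A`, `ker π ⊆ · (ker π|_B ⊗ P)` with `B = P^A`. -/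
def IsExactHopfMap [HopfAlgebra ℂ P] (π : P →ₐc[ℂ] A) : Prop :=
  ∀ u, π u = 0 → u ∈ Submodule.span ℂ
    {y | ∃ b ∈ invariants (homogeneousCoaction π), π b = 0 ∧ ∃ w, y = b * w}

end bundle

end QuantumHopf

end

noncomputable section

namespace QuantumHopf

/-! ### Star maps -/

/-! Indices start at 0, and a, b, c, d denote the entries of the matrix t of SU_q(2), read by rows.
For n = 2 the sphere relations say exactly that the matrix with rows (v¹, -q⁻¹v⁰) and (x₀, x₁)
satisfies the relations of SU_q(2) (`sphere_two_relations_iff`), so the two universal properties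
give mutually inverse maps. For n = 1 they say that v and x are inverse to each other, which gives
the Laurent polynomials. Involutions, coproducts and coactions are compared on generators. The
coaction is the ℤ-grading of P = S_q^3 with xᵢ in degree 1 and vⁱ in degree -1, and the remaining
claims concern this grading.

Exactness of δ. Let J be the right ideal generated by the invariants that δ kills. It contains b and
c, because 1 = da - q bc gives b = (bd)a - q(bc)b, and similarly for c. Modulo J every u therefore
equals σ(δ u), where σ is the linear section sending Tⁿ to dⁿ and T⁻ⁿ to aⁿ
(`sub_torusSection_mem`). If δ u = 0, then u lies in J.

Principal bundle. Nesting the identities x₀v⁰ + x₁v¹ = 1 and q⁻²v⁰x₀ + v¹x₁ = 1 produces, for every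
n, a tensor ωₙ in Pₙ ⊗ P₋ₙ with product 1 (`exists_connection`). The map zⁿ ⊗ p ↦ ωₙ(1 ⊗ p) is a
section of χ, hence freeness. An element of degree n times an element of P₋ₙ is invariant and may
cross the tensor sign modulo horizontal forms. Every tensor therefore differs from its image under χ
followed by the section by a horizontal form (`sub_translation_mem_horizontalForms`), hence
exactness.

Base. Let C be generated by the products vⁱxⱼ, and let X, V be the spans of the x's and of the v's.
Then P is the sum of all CXⁿ and CVⁿ, and the projection to degree 0 shows that the invariants are C
(`invariants_eq_base`). The Podleś sphere maps onto C. For injectivity (`podlesHom_injective`), it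
is spanned by the elements p(A)Bⁿ and p(A)(B⋆)ⁿ, and a representation of P on ℤ-indexed sequences of
polynomials separates them: A is diagonal with entries nonzero multiples of a formal variable, while
B and B⋆ move the position. Since the variable is formal, the powers of q need not be distinct, and
q = ±1 is covered. -/

theorem map_star_of_adjoin {A B : Type*} [Ring A] [Algebra ℂ A] [StarRing A] [StarModule ℂ A]
    [Ring B] [Algebra ℂ B] [StarRing B] [StarModule ℂ B] (f : A →ₐ[ℂ] B) {s : Set A}
    (hs : Algebra.adjoin ℂ s = ⊤) (h : ∀ x ∈ s, f (star x) = star (f x)) (u : A) :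
    f (star u) = star (f u) := by
  have hu : u ∈ Algebra.adjoin ℂ s := by rw [hs]; trivial
  induction hu using Algebra.adjoin_induction with
  | mem x hx => exact h x hx
  | algebraMap r =>
    rw [AlgHom.commutes, ← algebraMap_star_comm, ← algebraMap_star_comm, AlgHom.commutes]
  | add x y _ _ hx hy => simp only [star_add, map_add, hx, hy]
  | mul x y _ _ hx hy => simp only [star_mul, map_mul, hx, hy]

/-- A subspace which contains `1` and is stable under left multiplication by generators is the
whole algebra. -/
theorem submodule_eq_top_of_mul_left {A : Type*} [Ring A] [Algebra ℂ A] {s : Set A}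
    (hs : Algebra.adjoin ℂ s = ⊤) (M : Submodule ℂ A) (h1 : 1 ∈ M)
    (h : ∀ g ∈ s, ∀ y ∈ M, g * y ∈ M) : M = ⊤ := by
  have key : ∀ u : A, ∀ y ∈ M, u * y ∈ M := by
    intro u
    have hu : u ∈ Algebra.adjoin ℂ s := by rw [hs]; trivial
    induction hu using Algebra.adjoin_induction with
    | mem x hx => exact h x hx
    | algebraMap r => intro y hy; rw [← Algebra.smul_def]; exact M.smul_mem _ hy
    | add x y _ _ hx hy => intro z hz; rw [add_mul]; exact M.add_mem (hx z hz) (hy z hz)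
    | mul x y _ _ hx hy => intro z hz; rw [mul_assoc]; exact hx _ (hy z hz)
  exact eq_top_iff.2 fun u _ => by simpa using key u 1 h1

/-- A subspace which contains `1` and is stable under right multiplication by generators is the
whole algebra. -/
theorem submodule_eq_top_of_mul_right {A : Type*} [Ring A] [Algebra ℂ A] {s : Set A}
    (hs : Algebra.adjoin ℂ s = ⊤) (M : Submodule ℂ A) (h1 : 1 ∈ M)
    (h : ∀ g ∈ s, ∀ y ∈ M, y * g ∈ M) : M = ⊤ := by
  have key : ∀ u : A, ∀ y ∈ M, y * u ∈ M := by
    intro u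
    have hu : u ∈ Algebra.adjoin ℂ s := by rw [hs]; trivial
    induction hu using Algebra.adjoin_induction with
    | mem x hx => exact h x hx
    | algebraMap r =>
      intro y hy; rw [← Algebra.commutes, ← Algebra.smul_def]; exact M.smul_mem _ hy
    | add x y _ _ hx hy => intro z hz; rw [mul_add]; exact M.add_mem (hx z hz) (hy z hz)
    | mul x y _ _ hx hy => intro z hz; rw [← mul_assoc]; exact hy _ (hx z hz)
  exact eq_top_iff.2 fun u _ => by simpa using key u 1 h1

/-! ### The relations of `S_q^3` -/

set_option linter.unnecessarySeqFocus false

/-- The partial transpose of the bracketed matrix is the identity on the basis vectors (0,1), (1,0).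
On (0,0), (1,1) it is upper triangular with diagonal q and corner q - q⁻¹, so its inverse can be
written down and checked. -/
theorem RcoreTilde_two {q : ℝ} (hq : q ≠ 0) (i j k l : Fin 2) : RcoreTilde 2 q (i, j) (k, l) =
    if i = k ∧ j = l then (if i = j then q⁻¹ else 1)
    else if i = l ∧ j = k ∧ i < j then -(q - q⁻¹) * q⁻¹ ^ 2 else 0 := by
  have h : (Matrix.of fun x y : Fin 2 × Fin 2 => Rcore 2 q (x.1, y.2) (y.1, x.2))⁻¹ =
      Matrix.of fun x y : Fin 2 × Fin 2 =>
        if x.1 = y.1 ∧ y.2 = x.2 then (if x.1 = y.2 then q⁻¹ else 1)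
        else if x.1 = x.2 ∧ y.2 = y.1 ∧ x.1 < y.2 then -(q - q⁻¹) * q⁻¹ ^ 2 else 0 := by
    apply Matrix.inv_eq_right_inv
    ext ⟨a, b⟩ ⟨c, d⟩
    simp only [Matrix.mul_apply, Fintype.sum_prod_type, Fin.sum_univ_two, Matrix.of_apply, Rcore,
      Matrix.one_apply]
    fin_cases a <;> fin_cases b <;> fin_cases c <;> fin_cases d <;> simp [hq] <;> field_simp <;>
      ring
  rw [RcoreTilde, h]
  rfl

/-- The quantum metric is diagonal with entries q⁻² and 1, so the norm relation q⁻²v⁰x₀ + v¹x₁ = 1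
is the relation for `ad`. Combined with the exchange rule for x₁v¹ it gives `da`. The other exchange
and commutation rules match the remaining entries one by one. -/
theorem sphere_two_relations_iff {q : ℝ} (hq : q ≠ 0) {B : Type*} [Ring B] [Algebra ℂ B]
    (V X : Fin 2 → B) : SUq.IsQMat q (V 1) (-((q : ℂ)⁻¹ • V 0)) (X 0) (X 1) ↔
      (∀ i j, V i * V j = ∑ k, ∑ l, ((lam 2 q)⁻¹ * Rmat 2 q (i, j) (k, l)) • (V l * V k)) ∧
      (∀ i j, X i * X j = ∑ k, ∑ l, ((lam 2 q)⁻¹ * Rmat 2 q (k, l) (i, j)) • (X l * X k)) ∧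
      (∀ i j, X i * V j = ∑ k, ∑ l, (lam 2 q * Rtilde 2 q (l, j) (i, k)) • (V k * X l)) ∧
      ∑ a, ∑ b, metric 2 q b a • (V a * X b) = 1 := by
  have hq' : (q : ℂ) ≠ 0 := by exact_mod_cast hq
  simp only [lam_inv_mul_Rmat hq, lam_mul_Rtilde hq, metric, RcoreTilde_two hq,
    Rcore, Matrix.of_apply, Prod.mk.injEq, Fin.forall_fin_two, Fin.sum_univ_two]
  simp only [mul_add, lam_mul_Rtilde hq, RcoreTilde_two hq]
  simp [-Complex.coe_smul, hq]
  constructor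
  · rintro ⟨ba, ca, cb, db, dc, ad, da⟩
    simp only [neg_mul, mul_neg, smul_mul_assoc, mul_smul_comm, smul_neg, neg_inj] at *
    generalize (q : ℂ) = k at *
    rw [smul_comm k, smul_right_inj (inv_ne_zero hq')] at ba db
    rw [smul_right_inj (inv_ne_zero hq')] at cb
    rw [ba, dc, cb, ca, db, da, ad]
    refine ⟨⟨?_, ?_⟩, ⟨?_, ?_⟩, ⟨⟨rfl, rfl⟩, rfl, ?_⟩, ?_⟩
    all_goals (match_scalars <;> field_simp <;> ring)
  -- The relations for the index pairs (0,1) and (1,0) are equivalent, for vectors as for covectors,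
  -- so one of each pair suffices.
  · rintro ⟨⟨-, h1⟩, ⟨h2, -⟩, ⟨⟨h3, h4⟩, h5, h6⟩, h7⟩
    constructor <;> try simp only [neg_mul, mul_neg, smul_mul_assoc, mul_smul_comm, smul_neg, neg_inj]
    all_goals
      generalize (q : ℂ) = k at *
    · rw [h1, smul_smul, smul_smul]; simp [hq']
    · exact h4
    · rw [h3]
    · rw [h5, smul_comm]
    · rw [h2, smul_smul]; simp [hq']
    · rw [← h7]
      match_scalars <;> field_simp <;> ring
    · rw [h6, ← h7]
      match_scalars <;> field_simp <;> ring

namespace QSphere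
variable {q : ℝ} [NeZero q]

theorem isQMat_sphere :
    SUq.IsQMat q (v (n := 2) q 1) (-((q : ℂ)⁻¹ • v q 0)) (x q 0) (x q 1) :=
  (sphere_two_relations_iff (NeZero.ne q) _ _).2 ⟨v_mul_v, x_mul_x, x_mul_v, norm_eq⟩

/-- The universal property of `S_q^3`. -/
def lift₂ {B : Type*} [Ring B] [Algebra ℂ B] (V X : Fin 2 → B)
    (h : SUq.IsQMat q (V 1) (-((q : ℂ)⁻¹ • V 0)) (X 0) (X 1)) : QSphere 2 q →ₐ[ℂ] B :=
  have h' := (sphere_two_relations_iff (NeZero.ne q) V X).1 h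
  lift V X h'.1 h'.2.1 h'.2.2.1 h'.2.2.2

@[simp] theorem lift₂_v {B : Type*} [Ring B] [Algebra ℂ B] (V X : Fin 2 → B) (h) (i : Fin 2) :
    lift₂ (q := q) V X h (v q i) = V i := by simp [lift₂]

@[simp] theorem lift₂_x {B : Type*} [Ring B] [Algebra ℂ B] (V X : Fin 2 → B) (h) (i : Fin 2) :
    lift₂ (q := q) V X h (x q i) = X i := by simp [lift₂]

/-! ### Reordering rules for the generators of S_q^3 -/

theorem v_one_mul_v_zero : v (n := 2) q 1 * v q 0 = (q : ℂ)⁻¹ • (v q 0 * v q 1) := by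
  have hq : (q : ℂ) ≠ 0 := by exact_mod_cast NeZero.ne q
  have := (isQMat_sphere (q := q)).ba
  simp only [neg_mul, mul_neg, smul_mul_assoc, mul_smul_comm, smul_neg, neg_inj] at this
  rw [this, smul_inv_smul₀ hq]

theorem x_one_mul_x_zero : x (n := 2) q 1 * x q 0 = (q : ℂ) • (x q 0 * x q 1) :=
  (isQMat_sphere (q := q)).dc

theorem x_zero_mul_v_zero : x (n := 2) q 0 * v q 0 = v q 0 * x q 0 := by
  have hq : (q : ℂ) ≠ 0 := by exact_mod_cast NeZero.ne q
  have := (isQMat_sphere (q := q)).cb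
  simp only [neg_mul, mul_neg, smul_mul_assoc, mul_smul_comm, neg_inj] at this
  exact (smul_right_inj (inv_ne_zero hq)).1 this

theorem x_zero_mul_v_one : x (n := 2) q 0 * v q 1 = (q : ℂ) • (v q 1 * x q 0) :=
  (isQMat_sphere (q := q)).ca

theorem x_one_mul_v_zero : x (n := 2) q 1 * v q 0 = (q : ℂ) • (v q 0 * x q 1) := by
  have hq : (q : ℂ) ≠ 0 := by exact_mod_cast NeZero.ne q
  have := (isQMat_sphere (q := q)).db
  simp only [neg_mul, mul_neg, smul_mul_assoc, mul_smul_comm, smul_neg, neg_inj] at this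
  rw [smul_comm, smul_right_inj (inv_ne_zero hq)] at this
  exact this

/-- This rule and `x_one_mul_v_one` are the two partitions of unity, with v to the left of x and
with x to the left of v. They build the connection in negative and in positive degrees respectively.
-/
theorem v_one_mul_x_one : v (n := 2) q 1 * x q 1 = 1 - ((q : ℂ)⁻¹ ^ 2) • (v q 0 * x q 0) := by
  have := (isQMat_sphere (q := q)).ad
  rw [this, neg_mul, smul_mul_assoc, smul_neg, smul_smul, pow_two, sub_eq_add_neg]

theorem x_one_mul_v_one : x (n := 2) q 1 * v q 1 = 1 - v q 0 * x q 0 := by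
  have hq : (q : ℂ) ≠ 0 := by exact_mod_cast NeZero.ne q
  have := (isQMat_sphere (q := q)).da
  rw [this, neg_mul, smul_mul_assoc, smul_neg, smul_inv_smul₀ hq, sub_eq_add_neg]

end QSphere

/-! ### The isomorphism `S_q^3 ≅ SU_q(2)` -/

section
variable (q : ℝ) [NeZero q]

/-- The isomorphism `S_q^3 ≅ SU_q(2)` which sends the covector generators to the second row. -/
def sphereEquiv : QSphere 2 q ≃ₐ[ℂ] SUq 2 q :=
  have hq : (q : ℂ) ≠ 0 := by exact_mod_cast NeZero.ne q
  AlgEquiv.ofAlgHom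
    -- The images of the vⁱ are forced by compatibility with the involutions: vⁱ = xᵢ⋆ must go to
    -- the star of the entry (1, i), that is to S of the entry (i, 1).
    (QSphere.lift₂ ![-((q : ℂ) • SUq.t q 0 1), SUq.t q 0 0] ![SUq.t q 1 0, SUq.t q 1 1]
      (by simpa [-Complex.coe_smul, smul_smul, hq] using SUq.isQMat_t (q := q)))
    (SUq.lift ![![QSphere.v q 1, -((q : ℂ)⁻¹ • QSphere.v q 0)], ![QSphere.x q 0, QSphere.x q 1]]
      (by simpa using QSphere.isQMat_sphere (q := q)))
    (SUq.algHom_ext fun i j => by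
      fin_cases i <;> fin_cases j <;> simp [-Complex.coe_smul, smul_smul, hq])
    (QSphere.algHom_ext
      (fun i => by fin_cases i <;> simp [-Complex.coe_smul, smul_smul, hq])
      (fun i => by fin_cases i <;> simp))

@[simp] theorem sphereEquiv_v_zero :
    sphereEquiv q (QSphere.v q 0) = -((q : ℂ) • SUq.t q 0 1) := QSphere.lift₂_v _ _ _ _

@[simp] theorem sphereEquiv_v_one :
    sphereEquiv q (QSphere.v q 1) = SUq.t q 0 0 := QSphere.lift₂_v _ _ _ _

@[simp] theorem sphereEquiv_x (i : Fin 2) :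
    sphereEquiv q (QSphere.x q i) = SUq.t q 1 i := by
  refine (QSphere.lift₂_x _ _ _ _).trans ?_
  fin_cases i <;> rfl

theorem sphereEquiv_star (u : QSphere 2 q) :
    sphereEquiv q (star u) = star (sphereEquiv q u) := by
  refine map_star_of_adjoin (sphereEquiv q : QSphere 2 q →ₐ[ℂ] SUq 2 q) QSphere.adjoin_gens ?_ u
  have h : ∀ i, sphereEquiv q (QSphere.v q i) = star (sphereEquiv q (QSphere.x q i)) := by
    intro i
    fin_cases i <;> simp [SUq.antipode_t, SUq.antipodeMat]
  rintro _ (⟨i, rfl⟩ | ⟨i, rfl⟩)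
  · change sphereEquiv q _ = star (sphereEquiv q _)
    rw [h, star_star, QSphere.star_v]
  · change sphereEquiv q _ = star (sphereEquiv q _)
    rw [← h, QSphere.star_x]

/-! ### The isomorphism `S_q^1 ≅ U_q(1)` -/

/-- The algebra map from the Laurent polynomials determined by an invertible element. -/
def laurentLift {B : Type*} [Ring B] [Algebra ℂ B] (U : Bˣ) : ℂ[T;T⁻¹] →ₐ[ℂ] B :=
  AddMonoidAlgebra.lift ℂ B ℤ ((Units.coeHom B).comp (zpowersHom Bˣ U))

@[simp] theorem laurentLift_T {B : Type*} [Ring B] [Algebra ℂ B] (U : Bˣ) (n : ℤ) :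
    laurentLift U (LaurentPolynomial.T n) = (U ^ n : Bˣ) := by
  simp [laurentLift, LaurentPolynomial.T, -LaurentPolynomial.single_eq_C_mul_T]

theorem laurent_algHom_ext {B : Type*} [Ring B] [Algebra ℂ B] {f g : ℂ[T;T⁻¹] →ₐ[ℂ] B}
    (h : f (LaurentPolynomial.T 1) = g (LaurentPolynomial.T 1)) : f = g := by
  apply AddMonoidAlgebra.algHom_ext'
  · apply MonoidHom.ext_mint
    exact h
  · ext

theorem laurent_T_mul_T_neg (n : ℤ) :
    (LaurentPolynomial.T n * LaurentPolynomial.T (-n) : ℂ[T;T⁻¹]) = 1 := by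
  rw [← LaurentPolynomial.T_add, add_neg_cancel, LaurentPolynomial.T_zero]

theorem laurent_T_neg_mul_T (n : ℤ) :
    (LaurentPolynomial.T (-n) * LaurentPolynomial.T n : ℂ[T;T⁻¹]) = 1 := by
  rw [← LaurentPolynomial.T_add, neg_add_cancel, LaurentPolynomial.T_zero]

/-- The generator of `S_q^1` as a unit. -/
def circleUnit : (QSphere 1 q)ˣ :=
  ⟨QSphere.x q 0, QSphere.v q 0, QSphere.x_mul_v_one 0 0, QSphere.v_mul_x_one 0 0⟩

/-- The isomorphism `S_q^1 ≅ U_q(1)` of algebras. -/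
def circleAlgEquiv : QSphere 1 q ≃ₐ[ℂ] ℂ[T;T⁻¹] :=
  AlgEquiv.ofAlgHom
    (QSphere.lift₁ (LaurentPolynomial.T (-1)) (LaurentPolynomial.T 1)
      (laurent_T_mul_T_neg 1) (laurent_T_neg_mul_T 1))
    (laurentLift (circleUnit q))
    (laurent_algHom_ext (by simp [circleUnit]))
    (QSphere.algHom_ext (fun i => by simp [Subsingleton.elim i 0, circleUnit])
      (fun i => by simp [Subsingleton.elim i 0, circleUnit]))

@[simp] theorem circleAlgEquiv_x (i : Fin 1) :
    circleAlgEquiv q (QSphere.x q i) = LaurentPolynomial.T 1 := QSphere.lift₁_x _ _ _ _ _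

@[simp] theorem circleAlgEquiv_v (i : Fin 1) :
    circleAlgEquiv q (QSphere.v q i) = LaurentPolynomial.T (-1) := QSphere.lift₁_v _ _ _ _ _

/-- The isomorphism `S_q^1 ≅ U_q(1)` of Hopf algebras. -/
def circleEquiv : QSphere 1 q ≃ₐc[ℂ] ℂ[T;T⁻¹] :=
  BialgEquiv.ofAlgEquiv (circleAlgEquiv q)
    (QSphere.algHom_ext (fun i => by simp) (fun i => by simp))
    (QSphere.algHom_ext (fun i => by simp) (fun i => by simp))

@[simp] theorem circleEquiv_x (i : Fin 1) :
    circleEquiv q (QSphere.x q i) = LaurentPolynomial.T 1 := circleAlgEquiv_x q i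

@[simp] theorem circleEquiv_v (i : Fin 1) :
    circleEquiv q (QSphere.v q i) = LaurentPolynomial.T (-1) := circleAlgEquiv_v q i

theorem circleEquiv_star (u : QSphere 1 q) :
    circleEquiv q (star u) = star (circleEquiv q u) := by
  refine map_star_of_adjoin (circleAlgEquiv q : QSphere 1 q →ₐ[ℂ] ℂ[T;T⁻¹])
    QSphere.adjoin_gens ?_ u
  rintro _ (⟨i, rfl⟩ | ⟨i, rfl⟩) <;> simp

/-! ### The map `SU_q(2) → U_q(1)` -/

/-- The restriction of functions on `SU_q(2)` to the diagonal circle, as an algebra map. -/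
def torusAlgHom : SUq 2 q →ₐ[ℂ] ℂ[T;T⁻¹] :=
  SUq.lift ![![LaurentPolynomial.T (-1), 0], ![0, LaurentPolynomial.T 1]]
    (by constructor <;> simp [laurent_T_mul_T_neg 1, laurent_T_neg_mul_T 1])

/-- The exponent `2 * i - 1` takes the values -1 and 1 on the two rows; it is the degree of row i
under the coaction. -/
theorem torusAlgHom_t (i j : Fin 2) : torusAlgHom q (SUq.t q i j) =
    if i = j then LaurentPolynomial.T (2 * i - 1) else 0 := by
  refine (SUq.lift_t _ _ _ _).trans ?_
  fin_cases i <;> fin_cases j <;> simp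

/-- The Hopf algebra map `SU_q(2) → U_q(1)` which restricts to the diagonal circle. -/
def torusHom : SUq 2 q →ₐc[ℂ] ℂ[T;T⁻¹] :=
  BialgHom.ofAlgHom (torusAlgHom q)
    (SUq.algHom_ext fun i j => by
      fin_cases i <;> fin_cases j <;> simp [torusAlgHom_t])
    (SUq.algHom_ext fun i j => by
      fin_cases i <;> fin_cases j <;> simp [torusAlgHom_t])

theorem torusHom_t (i j : Fin 2) : torusHom q (SUq.t q i j) =
    if i = j then LaurentPolynomial.T (2 * i - 1) else 0 := torusAlgHom_t q i j

theorem torusHom_star (u : SUq 2 q) : torusHom q (star u) = star (torusHom q u) := by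
  refine map_star_of_adjoin (torusAlgHom q) SUq.adjoin_gens ?_ u
  rintro _ ⟨⟨i, j⟩, rfl⟩
  fin_cases i <;> fin_cases j <;>
    simp [-Complex.coe_smul, torusAlgHom_t, SUq.antipode_t, SUq.antipodeMat]

theorem homogeneousCoaction_torusHom_t (i j : Fin 2) :
    homogeneousCoaction (torusHom q) (SUq.t q i j) =
      LaurentPolynomial.T (2 * i - 1) ⊗ₜ[ℂ] SUq.t q i j := by
  fin_cases i <;> simp [homogeneousCoaction, Fin.sum_univ_two, torusHom_t]

/-! ### The coaction of `S_q^1` on `S_q^3` -/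

/-- The coaction of `S_q^1` on `S_q^3` given on generators by `xᵢ ↦ x ⊗ xᵢ` and `vⁱ ↦ v ⊗ vⁱ`. -/
def sphereCoaction : QSphere 2 q →ₐ[ℂ] QSphere 1 q ⊗[ℂ] QSphere 2 q :=
  QSphere.lift₂ (fun i => QSphere.v q 0 ⊗ₜ[ℂ] QSphere.v q i)
    (fun i => QSphere.x q 0 ⊗ₜ[ℂ] QSphere.x q i) (by
      obtain ⟨ba, ca, cb, db, dc, ad, da⟩ := QSphere.isQMat_sphere (q := q)
      rw [← TensorProduct.tmul_smul, ← TensorProduct.tmul_neg]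
      constructor <;> simp only [Algebra.TensorProduct.tmul_mul_tmul, ba, ca, cb, db, dc, ad, da,
        QSphere.x_mul_v_one, QSphere.v_mul_x_one, TensorProduct.tmul_add, TensorProduct.tmul_smul,
        Algebra.TensorProduct.one_def])

@[simp] theorem sphereCoaction_x (i : Fin 2) : sphereCoaction q (QSphere.x q i) =
    QSphere.x q 0 ⊗ₜ[ℂ] QSphere.x q i := QSphere.lift₂_x _ _ _ _

@[simp] theorem sphereCoaction_v (i : Fin 2) : sphereCoaction q (QSphere.v q i) =
    QSphere.v q 0 ⊗ₜ[ℂ] QSphere.v q i := QSphere.lift₂_v _ _ _ _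

theorem sphereCoaction_star (u : QSphere 2 q) :
    sphereCoaction q (star u) = star (sphereCoaction q u) := by
  refine map_star_of_adjoin (sphereCoaction q) QSphere.adjoin_gens ?_ u
  rintro _ (⟨i, rfl⟩ | ⟨i, rfl⟩) <;> simp [TensorProduct.star_tmul]

theorem map_sphereCoaction (u : QSphere 2 q) :
    TensorProduct.map (circleEquiv q : QSphere 1 q →ₗ[ℂ] ℂ[T;T⁻¹]) (sphereEquiv q).toLinearMap
      (sphereCoaction q u) = homogeneousCoaction (torusHom q) (sphereEquiv q u) := by
  have h : (Algebra.TensorProduct.map (circleAlgEquiv q : QSphere 1 q →ₐ[ℂ] ℂ[T;T⁻¹])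
      (sphereEquiv q : QSphere 2 q →ₐ[ℂ] SUq 2 q)).comp (sphereCoaction q) =
      (homogeneousCoaction (torusHom q)).comp (sphereEquiv q : QSphere 2 q →ₐ[ℂ] SUq 2 q) := by
    refine QSphere.algHom_ext (fun i => ?_) (fun i => ?_)
    · fin_cases i <;>
        simp [-Complex.coe_smul, homogeneousCoaction_torusHom_t, TensorProduct.tmul_neg]
    · simp [homogeneousCoaction_torusHom_t]
  exact congrArg (fun f => f u) h

theorem sphereCoaction_isLeftComoduleAlgebra : IsLeftComoduleAlgebra (sphereCoaction q) where
  coassoc u := by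
    have h : ((Algebra.TensorProduct.assoc ℂ ℂ ℂ (QSphere 1 q) (QSphere 1 q) (QSphere 2 q) :
          _ →ₐ[ℂ] _).comp (Algebra.TensorProduct.map (Bialgebra.comulAlgHom ℂ (QSphere 1 q))
          (AlgHom.id ℂ (QSphere 2 q)))).comp (sphereCoaction q) =
        (Algebra.TensorProduct.map (AlgHom.id ℂ (QSphere 1 q)) (sphereCoaction q)).comp
          (sphereCoaction q) :=
      QSphere.algHom_ext (fun i => by simp) (fun i => by simp)
    exact congrArg (fun f => f u) h
  counit u := by
    have h : ((Algebra.TensorProduct.lid ℂ (QSphere 2 q) : _ →ₐ[ℂ] _).comp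
        (Algebra.TensorProduct.map (Bialgebra.counitAlgHom ℂ (QSphere 1 q))
          (AlgHom.id ℂ (QSphere 2 q)))).comp (sphereCoaction q) = AlgHom.id ℂ _ :=
      QSphere.algHom_ext (fun i => by simp) (fun i => by simp)
    exact congrArg (fun f => f u) h

end

/-! ### Linear maps out of the Laurent polynomials -/

section
variable {M : Type*} [AddCommGroup M] [Module ℂ M]

/-- The linear map from the Laurent polynomials with prescribed values on the basis `Tⁿ`. -/
def laurentLinear (f : ℤ → M) : ℂ[T;T⁻¹] →ₗ[ℂ] M :=
  Finsupp.linearCombination ℂ f ∘ₗ (AddMonoidAlgebra.coeffLinearEquiv ℂ).toLinearMap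

@[simp] theorem laurentLinear_T (f : ℤ → M) (n : ℤ) :
    laurentLinear f (LaurentPolynomial.T n) = f n := by
  simp [laurentLinear, LaurentPolynomial.T, -LaurentPolynomial.single_eq_C_mul_T]

theorem laurent_induction {N : Submodule ℂ ℂ[T;T⁻¹]} (h : ∀ n, LaurentPolynomial.T n ∈ N)
    (p : ℂ[T;T⁻¹]) : p ∈ N := by
  induction p using LaurentPolynomial.induction_on' with
  | add p q hp hq => exact N.add_mem hp hq
  | C_mul_T n a =>
    rw [← LaurentPolynomial.smul_eq_C_mul]
    exact N.smul_mem _ (h n)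

end

theorem pow_mul_of_mul_eq_smul {A : Type*} [Ring A] [Algebra ℂ A] {g h : A} {k : ℂ}
    (hgh : g * h = k • (h * g)) (n : ℕ) : g ^ n * h = k ^ n • (h * g ^ n) := by
  induction n with
  | zero => simp
  | succ n ih =>
    rw [pow_succ g, mul_assoc, hgh, mul_smul_comm, ← mul_assoc, ih, smul_mul_assoc, smul_smul,
      mul_assoc, pow_succ']

/-! ### Exactness of the map `SU_q(2) → U_q(1)` -/

section
variable (q : ℝ) [NeZero q]

/-- The right ideal generated by the invariants in the kernel of `torusHom`. -/
def torusIdeal : Submodule ℂ (SUq 2 q) := Submodule.span ℂ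
  {y | ∃ b ∈ invariants (homogeneousCoaction (torusHom q)), torusHom q b = 0 ∧ ∃ w, y = b * w}

variable {q}

theorem torusIdeal_mul_mem {u : SUq 2 q} (hu : u ∈ torusIdeal q) (w : SUq 2 q) :
    u * w ∈ torusIdeal q := by
  unfold torusIdeal at hu
  induction hu using Submodule.span_induction with
  | mem x hx =>
    obtain ⟨b, hb, hb0, w', rfl⟩ := hx
    exact Submodule.subset_span ⟨b, hb, hb0, w' * w, mul_assoc _ _ _⟩
  | zero => rw [zero_mul]; exact Submodule.zero_mem _
  | add x y _ _ hx hy => rw [add_mul]; exact Submodule.add_mem _ hx hy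
  | smul a x _ hx => rw [smul_mul_assoc]; exact Submodule.smul_mem _ _ hx

/-- The two rows have opposite degrees, so a product of entries from different rows is invariant.
The off-diagonal factor makes its image on the torus vanish. -/
theorem mul_t_mem_torusIdeal (i j : Fin 2) (h : i = 0 ∧ j = 1 ∨ i = 1 ∧ j = 0)
    (k l : Fin 2) (hkl : k ≠ i) (w : SUq 2 q) :
    SUq.t q i j * SUq.t q k l * w ∈ torusIdeal q := by
  refine Submodule.subset_span ⟨_, ?_, ?_, w, rfl⟩
  · rw [mem_invariants, map_mul, homogeneousCoaction_torusHom_t, homogeneousCoaction_torusHom_t,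
      Algebra.TensorProduct.tmul_mul_tmul, ← LaurentPolynomial.T_add, ← LaurentPolynomial.T_zero]
    congr 2
    rcases h with ⟨rfl, rfl⟩ | ⟨rfl, rfl⟩ <;> fin_cases k <;> simp_all
  · rw [map_mul, torusHom_t]
    rcases h with ⟨rfl, rfl⟩ | ⟨rfl, rfl⟩ <;> simp

/-- An off-diagonal entry is not itself invariant, but inserting the determinant relation to its
right writes it through invariant products. -/
theorem t_mul_mem_torusIdeal (i j : Fin 2) (h : i ≠ j) (w : SUq 2 q) :
    SUq.t q i j * w ∈ torusIdeal q := by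
  have hq : (q : ℂ) ≠ 0 := by exact_mod_cast NeZero.ne q
  obtain ⟨ba, ca, cb, db, dc, ad, da⟩ := SUq.isQMat_t (q := q)
  have hb : ∀ w, SUq.t q 0 1 * w ∈ torusIdeal q := by
    intro w
    -- This is 1 = da - q cb inserted between b and w; for c below, 1 = ad - q⁻¹ bc plays this role.
    have : SUq.t q 0 1 * w = SUq.t q 0 1 * SUq.t q 1 1 * (SUq.t q 0 0 * w) -
        (q : ℂ) • (SUq.t q 0 1 * SUq.t q 1 0 * (SUq.t q 0 1 * w)) := by
      simp only [← mul_assoc]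
      rw [mul_assoc _ (SUq.t q 1 1), da, mul_assoc _ (SUq.t q 1 0), cb]
      simp [-Complex.coe_smul, mul_add, add_mul, mul_assoc]
    rw [this]
    exact sub_mem (mul_t_mem_torusIdeal 0 1 (by simp) 1 1 (by simp) _)
      (Submodule.smul_mem _ _ (mul_t_mem_torusIdeal 0 1 (by simp) 1 0 (by simp) _))
  have hc : ∀ w, SUq.t q 1 0 * w ∈ torusIdeal q := by
    intro w
    have : SUq.t q 1 0 * w = SUq.t q 1 0 * SUq.t q 0 0 * (SUq.t q 1 1 * w) -
        (q : ℂ)⁻¹ • (SUq.t q 1 0 * SUq.t q 0 1 * (SUq.t q 1 0 * w)) := by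
      simp only [← mul_assoc]
      rw [mul_assoc _ (SUq.t q 0 0), ad, mul_assoc _ (SUq.t q 0 1)]
      simp [-Complex.coe_smul, mul_add, add_mul, mul_assoc]
    rw [this]
    exact sub_mem (mul_t_mem_torusIdeal 1 0 (by simp) 0 0 (by simp) _)
      (Submodule.smul_mem _ _ (mul_t_mem_torusIdeal 1 0 (by simp) 0 1 (by simp) _))
  fin_cases i <;> fin_cases j
  · exact absurd rfl h
  · exact hb w
  · exact hc w
  · exact absurd rfl h

variable (q) in
/-- The linear section of `torusHom` with `Tⁿ ↦ dⁿ` and `T⁻ⁿ ↦ aⁿ` for `n ≥ 0`. -/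
def torusSection : ℂ[T;T⁻¹] →ₗ[ℂ] SUq 2 q :=
  laurentLinear fun n => if 0 ≤ n then SUq.t q 1 1 ^ n.toNat else SUq.t q 0 0 ^ (-n).toNat

theorem torusSection_T_nat (n : ℕ) :
    torusSection q (LaurentPolynomial.T n) = SUq.t q 1 1 ^ n := by
  simp [torusSection]

theorem torusSection_one : torusSection q 1 = 1 := by
  simpa using torusSection_T_nat (q := q) 0

theorem torusSection_T_neg_nat (n : ℕ) :
    torusSection q (LaurentPolynomial.T (-n)) = SUq.t q 0 0 ^ n := by
  rcases n with _ | n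
  · simp [torusSection_one]
  · rw [torusSection, laurentLinear_T, if_neg (by push_cast; omega)]
    simp

/-- The section is not multiplicative, but its failure on right multiplication by a generator comes
only from `da` and `ad` differing from 1 by a multiple of bc, and from the off-diagonal entries. All
of these lie in the right ideal. -/
theorem torusSection_mul_sub_mem (i j : Fin 2) (n : ℤ) :
    torusSection q (LaurentPolynomial.T n) * SUq.t q i j -
      torusSection q (LaurentPolynomial.T n * torusHom q (SUq.t q i j)) ∈ torusIdeal q := by
  have hq : (q : ℂ) ≠ 0 := by exact_mod_cast NeZero.ne q
  obtain ⟨ba, ca, cb, db, dc, ad, da⟩ := SUq.isQMat_t (q := q)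
  have ab : SUq.t (n := 2) q 0 0 * SUq.t q 0 1 = (q : ℂ)⁻¹ • (SUq.t q 0 1 * SUq.t q 0 0) := by
    rw [ba, inv_smul_smul₀ hq]
  have ac : SUq.t (n := 2) q 0 0 * SUq.t q 1 0 = (q : ℂ)⁻¹ • (SUq.t q 1 0 * SUq.t q 0 0) := by
    rw [ca, inv_smul_smul₀ hq]
  have hz : torusHom q (SUq.t q 0 1) = 0 := by simp [torusHom_t]
  have hz' : torusHom q (SUq.t q 1 0) = 0 := by simp [torusHom_t]
  have ha : torusHom q (SUq.t q 0 0) = LaurentPolynomial.T (-1) := by simp [torusHom_t]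
  have hd : torusHom q (SUq.t q 1 1) = LaurentPolynomial.T 1 := by simp [torusHom_t]
  -- The ideal is only a right ideal, so the off-diagonal entry must be brought to the front; it
  -- passes the power at the cost of a scalar.
  have key1 : ∀ m (i j : Fin 2), i ≠ j → SUq.t q 1 1 ^ m * SUq.t q i j ∈ torusIdeal q := by
    intro m i j hij
    fin_cases i <;> fin_cases j
    · exact absurd rfl hij
    · change _ * SUq.t q 0 1 ∈ _
      rw [pow_mul_of_mul_eq_smul db]
      exact Submodule.smul_mem _ _ (t_mul_mem_torusIdeal _ _ hij _)
    · change _ * SUq.t q 1 0 ∈ _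
      rw [pow_mul_of_mul_eq_smul dc]
      exact Submodule.smul_mem _ _ (t_mul_mem_torusIdeal _ _ hij _)
    · exact absurd rfl hij
  have key2 : ∀ m (i j : Fin 2), i ≠ j → SUq.t q 0 0 ^ m * SUq.t q i j ∈ torusIdeal q := by
    intro m i j hij
    fin_cases i <;> fin_cases j
    · exact absurd rfl hij
    · change _ * SUq.t q 0 1 ∈ _
      rw [pow_mul_of_mul_eq_smul ab]
      exact Submodule.smul_mem _ _ (t_mul_mem_torusIdeal _ _ hij _)
    · change _ * SUq.t q 1 0 ∈ _
      rw [pow_mul_of_mul_eq_smul ac]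
      exact Submodule.smul_mem _ _ (t_mul_mem_torusIdeal _ _ hij _)
    · exact absurd rfl hij
  have key : i ≠ j → torusSection q (LaurentPolynomial.T n) * SUq.t q i j ∈ torusIdeal q := by
    intro hij
    obtain ⟨m, rfl | rfl⟩ := n.eq_nat_or_neg
    · rw [torusSection_T_nat]; exact key1 m i j hij
    · rw [torusSection_T_neg_nat]; exact key2 m i j hij
  fin_cases i <;> fin_cases j
  · change _ * SUq.t q 0 0 - torusSection q (_ * torusHom q (SUq.t q 0 0)) ∈ _
    rw [ha, ← LaurentPolynomial.T_add]
    obtain ⟨m, rfl | rfl⟩ := n.eq_nat_or_neg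
    -- At exponent 0 the section passes from powers of d to powers of a, and the two sides agree
    -- exactly.
    · rcases m with _ | m
      · have h2 := torusSection_T_neg_nat (q := q) 1
        simp only [Nat.cast_one, pow_one] at h2
        simp [torusSection_one, h2]
      · have h3 : ((m + 1 : ℕ) : ℤ) + -1 = m := by push_cast; ring
        rw [h3, torusSection_T_nat, torusSection_T_nat, pow_succ, mul_assoc, da, mul_add, mul_one,
          add_sub_cancel_left, mul_smul_comm, ← mul_assoc]
        exact Submodule.smul_mem _ _ (torusIdeal_mul_mem (key1 m 0 1 (by simp)) _)
    · have h3 : -(m : ℤ) + -1 = -((m + 1 : ℕ) : ℤ) := by push_cast; ring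
      rw [h3, torusSection_T_neg_nat, torusSection_T_neg_nat, pow_succ, sub_self]
      exact Submodule.zero_mem _
  · change _ * SUq.t q 0 1 - torusSection q (_ * torusHom q (SUq.t q 0 1)) ∈ _
    rw [hz, mul_zero, map_zero, sub_zero]
    exact key (by simp)
  · change _ * SUq.t q 1 0 - torusSection q (_ * torusHom q (SUq.t q 1 0)) ∈ _
    rw [hz', mul_zero, map_zero, sub_zero]
    exact key (by simp)
  · change _ * SUq.t q 1 1 - torusSection q (_ * torusHom q (SUq.t q 1 1)) ∈ _
    rw [hd, ← LaurentPolynomial.T_add]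
    obtain ⟨m, rfl | rfl⟩ := n.eq_nat_or_neg
    · have h3 : (m : ℤ) + 1 = ((m + 1 : ℕ) : ℤ) := by push_cast; ring
      rw [h3, torusSection_T_nat, torusSection_T_nat, pow_succ, sub_self]
      exact Submodule.zero_mem _
    · rcases m with _ | m
      · have h2 := torusSection_T_nat (q := q) 1
        simp only [Nat.cast_one, pow_one] at h2
        simp [torusSection_one, h2]
      · have h3 : -((m + 1 : ℕ) : ℤ) + 1 = -(m : ℤ) := by push_cast; ring
        rw [h3, torusSection_T_neg_nat, torusSection_T_neg_nat, pow_succ, mul_assoc, ad, mul_add,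
          mul_one, add_sub_cancel_left, mul_smul_comm, ← mul_assoc]
        exact Submodule.smul_mem _ _ (torusIdeal_mul_mem (key2 m 0 1 (by simp)) _)

theorem sub_torusSection_mem (u : SUq 2 q) :
    u - torusSection q (torusHom q u) ∈ torusIdeal q := by
  let N : Submodule ℂ (SUq 2 q) := (torusIdeal q).comap
    (LinearMap.id - torusSection q ∘ₗ (torusAlgHom q).toLinearMap)
  have hN : N = ⊤ := by
    refine submodule_eq_top_of_mul_right SUq.adjoin_gens N ?_ ?_
    · change 1 - torusSection q (torusAlgHom q 1) ∈ torusIdeal q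
      rw [map_one, torusSection_one, sub_self]
      exact Submodule.zero_mem _
    · rintro _ ⟨⟨i, j⟩, rfl⟩ y hy
      change y - torusSection q (torusHom q y) ∈ torusIdeal q at hy
      change y * SUq.t q i j - torusSection q (torusHom q (y * SUq.t q i j)) ∈ torusIdeal q
      have h2 : ∀ L, torusSection q L * SUq.t q i j -
          torusSection q (L * torusHom q (SUq.t q i j)) ∈ torusIdeal q :=
        laurent_induction (N := (torusIdeal q).comap
          (LinearMap.mulRight ℂ (SUq.t q i j) ∘ₗ torusSection q -
            torusSection q ∘ₗ LinearMap.mulRight ℂ (torusHom q (SUq.t q i j))))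
          (torusSection_mul_sub_mem i j)
      -- Telescoping with g the generator: yg - σ(δ(y)δ(g)) is the sum of (y - σ(δ y))g and σ(δ y)g
      -- - σ(δ(y)δ(g)).
      have := add_mem (torusIdeal_mul_mem hy (SUq.t q i j)) (h2 (torusHom q y))
      rwa [sub_mul, sub_add_sub_cancel, ← map_mul] at this
  have : u ∈ N := by rw [hN]; trivial
  exact this

variable (q)

theorem torusHom_isExact : IsExactHopfMap (torusHom q) := by
  intro u hu
  have := sub_torusSection_mem u
  rwa [hu, map_zero, sub_zero] at this

theorem torusHom_surjective : Function.Surjective (torusHom q) := by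
  have h : ∀ p, p ∈ LinearMap.range (torusAlgHom q).toLinearMap := by
    refine laurent_induction fun n => ?_
    obtain ⟨m, rfl | rfl⟩ := n.eq_nat_or_neg
    · refine ⟨SUq.t q 1 1 ^ m, ?_⟩
      simp [torusAlgHom_t]
    · refine ⟨SUq.t q 0 0 ^ m, ?_⟩
      simp [torusAlgHom_t]
  exact h

end

/-! ### Subalgebras and subspaces which exchange with them -/

section
variable {A : Type*} [Ring A] [Algebra ℂ A] {C : Subalgebra ℂ A} {s : Set A} {Y Z : Submodule ℂ A}

theorem toSubmodule_mul_mul (C : Subalgebra ℂ A) (Y : Submodule ℂ A) :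
    Subalgebra.toSubmodule C * (Subalgebra.toSubmodule C * Y) = Subalgebra.toSubmodule C * Y := by
  rw [← mul_assoc, C.isIdempotentElem_toSubmodule.eq]

/-- A generator of C lies in ZY, so Y moves past it by Y(ZY) = (YZ)Y ⊆ CY; induction on products
extends this to all of C. -/
theorem mul_adjoin_le (hC : Algebra.adjoin ℂ s = C) (hs : s ⊆ (Z * Y : Submodule ℂ A))
    (hYZ : Y * Z ≤ Subalgebra.toSubmodule C) :
    Y * Subalgebra.toSubmodule C ≤ Subalgebra.toSubmodule C * Y := by
  refine Submodule.mul_le.2 fun y hy c hc => ?_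
  replace hc : c ∈ Algebra.adjoin ℂ s := by rw [hC]; exact hc
  induction hc using Algebra.adjoin_induction generalizing y with
  | mem c hc =>
    have h : Y * (Z * Y) ≤ Subalgebra.toSubmodule C * Y := by
      rw [← mul_assoc]; gcongr
    exact h (Submodule.mul_mem_mul hy (hs hc))
  | algebraMap r =>
    rw [← Algebra.commutes]
    exact Submodule.mul_mem_mul (C.algebraMap_mem r) hy
  | add a b _ _ ha hb => rw [mul_add]; exact add_mem (ha y hy) (hb y hy)
  | mul a b _ _ ha hb =>
    rw [← mul_assoc]
    have h := ha y hy
    generalize y * a = u at h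
    induction h using Submodule.mul_induction_on' with
    | mem_mul_mem c hc y hy =>
      rw [mul_assoc, ← toSubmodule_mul_mul]
      exact Submodule.mul_mem_mul hc (hb y hy)
    | add u _ v _ hu hv => rw [add_mul]; exact add_mem hu hv

theorem pow_mul_toSubmodule_le
    (h : Y * Subalgebra.toSubmodule C ≤ Subalgebra.toSubmodule C * Y) (n : ℕ) :
    Y ^ n * Subalgebra.toSubmodule C ≤ Subalgebra.toSubmodule C * Y ^ n := by
  induction n with
  | zero => simp
  | succ n ih =>
    calc Y ^ (n + 1) * Subalgebra.toSubmodule C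
        = Y ^ n * (Y * Subalgebra.toSubmodule C) := by rw [pow_succ, mul_assoc]
      _ ≤ Y ^ n * (Subalgebra.toSubmodule C * Y) := by gcongr
      _ = Y ^ n * Subalgebra.toSubmodule C * Y := by rw [mul_assoc]
      _ ≤ Subalgebra.toSubmodule C * Y ^ n * Y := by gcongr
      _ = Subalgebra.toSubmodule C * Y ^ (n + 1) := by rw [mul_assoc, pow_succ]

/-- The last Y cancels against Z into C, and that C is carried to the left through the remaining Yⁿ.
-/
theorem toSubmodule_mul_pow_mul_le
    (h : Y * Subalgebra.toSubmodule C ≤ Subalgebra.toSubmodule C * Y)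
    (hYZ : Y * Z ≤ Subalgebra.toSubmodule C) (n : ℕ) :
    Subalgebra.toSubmodule C * Y ^ (n + 1) * Z ≤ Subalgebra.toSubmodule C * Y ^ n :=
  calc Subalgebra.toSubmodule C * Y ^ (n + 1) * Z
      = Subalgebra.toSubmodule C * (Y ^ n * (Y * Z)) := by rw [pow_succ, mul_assoc, mul_assoc]
    _ ≤ Subalgebra.toSubmodule C * (Y ^ n * Subalgebra.toSubmodule C) := by
      gcongr
    _ ≤ Subalgebra.toSubmodule C * (Subalgebra.toSubmodule C * Y ^ n) := by
      gcongr Subalgebra.toSubmodule C * ?_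
      exact pow_mul_toSubmodule_le h n
    _ = Subalgebra.toSubmodule C * Y ^ n := toSubmodule_mul_mul _ _

/-- The subspaces `C Yⁿ` and `C Zⁿ` span the algebra. -/
theorem iSup_toSubmodule_mul_pow_eq_top (hC : Algebra.adjoin ℂ s = C)
    (hsZY : s ⊆ (Z * Y : Submodule ℂ A)) (hsYZ : s ⊆ (Y * Z : Submodule ℂ A))
    (hYZ : Y * Z ≤ Subalgebra.toSubmodule C) (hZY : Z * Y ≤ Subalgebra.toSubmodule C)
    (hgen : Algebra.adjoin ℂ (Y ∪ Z : Set A) = ⊤) :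
    ⨆ n : ℕ, (Subalgebra.toSubmodule C * Y ^ n ⊔ Subalgebra.toSubmodule C * Z ^ n) = ⊤ := by
  set T := ⨆ n : ℕ, (Subalgebra.toSubmodule C * Y ^ n ⊔ Subalgebra.toSubmodule C * Z ^ n) with hT
  have hY : ∀ n, Subalgebra.toSubmodule C * Y ^ n ≤ T := fun n =>
    le_sup_left.trans (le_iSup (fun n : ℕ =>
      Subalgebra.toSubmodule C * Y ^ n ⊔ Subalgebra.toSubmodule C * Z ^ n) n)
  have hZ : ∀ n, Subalgebra.toSubmodule C * Z ^ n ≤ T := fun n =>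
    le_sup_right.trans (le_iSup (fun n : ℕ =>
      Subalgebra.toSubmodule C * Y ^ n ⊔ Subalgebra.toSubmodule C * Z ^ n) n)
  have e1 := mul_adjoin_le hC hsZY hYZ
  have e2 := mul_adjoin_le hC hsYZ hZY
  have hTY : T * Y ≤ T := by
    rw [hT, Submodule.iSup_mul]
    refine iSup_le fun n => ?_
    rw [Submodule.sup_mul]
    refine sup_le ?_ ?_
    · rw [mul_assoc, ← pow_succ]; exact hY _
    -- Multiplication by Y lowers the exponent of Z, except at exponent 0, where it starts the
    -- powers of Y.
    · rcases n with _ | n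
      · rw [pow_zero, mul_one]
        simpa using hY 1
      · exact (toSubmodule_mul_pow_mul_le e2 hZY n).trans (hZ n)
  have hTZ : T * Z ≤ T := by
    rw [hT, Submodule.iSup_mul]
    refine iSup_le fun n => ?_
    rw [Submodule.sup_mul]
    refine sup_le ?_ ?_
    · rcases n with _ | n
      · rw [pow_zero, mul_one]
        simpa using hZ 1
      · exact (toSubmodule_mul_pow_mul_le e1 hYZ n).trans (hY n)
    · rw [mul_assoc, ← pow_succ]; exact hZ _
  refine submodule_eq_top_of_mul_right hgen T (hY 0 ?_) ?_
  · simp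
  · rintro g (hg | hg) y hy
    · exact hTY (Submodule.mul_mem_mul hy hg)
    · exact hTZ (Submodule.mul_mem_mul hy hg)

end

/-! ### The grading of `S_q^3` -/

section
variable (q : ℝ) [NeZero q]

/-- The powers of the generator of `S_q^1`. -/
def circlePow (n : ℤ) : QSphere 1 q := (circleUnit q ^ n : (QSphere 1 q)ˣ)

theorem circlePow_add (m n : ℤ) : circlePow q (m + n) = circlePow q m * circlePow q n := by
  simp [circlePow, zpow_add]

@[simp] theorem circlePow_zero : circlePow q 0 = 1 := by simp [circlePow]

theorem circlePow_one : circlePow q 1 = QSphere.x q 0 := by simp [circlePow, circleUnit]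

theorem circlePow_neg_one : circlePow q (-1) = QSphere.v q 0 := by simp [circlePow, circleUnit]

theorem circleAlgEquiv_symm_T (n : ℤ) :
    (circleAlgEquiv q).symm (LaurentPolynomial.T n) = circlePow q n :=
  laurentLift_T (circleUnit q) n

@[simp] theorem circleAlgEquiv_circlePow (n : ℤ) :
    circleAlgEquiv q (circlePow q n) = LaurentPolynomial.T n := by
  rw [← circleAlgEquiv_symm_T, AlgEquiv.apply_symm_apply]

theorem circle_induction {N : Submodule ℂ (QSphere 1 q)} (h : ∀ n, circlePow q n ∈ N)
    (a : QSphere 1 q) : a ∈ N := by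
  have := laurent_induction (N := N.comap (circleAlgEquiv q).symm.toLinearMap)
    (fun n => by simpa [circleAlgEquiv_symm_T] using h n) (circleAlgEquiv q a)
  simpa using this

/-- The elements of `S_q^3` of degree `n` for the coaction of `S_q^1`. -/
def degreePart (n : ℤ) : Submodule ℂ (QSphere 2 q) :=
  LinearMap.eqLocus (sphereCoaction q).toLinearMap (TensorProduct.mk ℂ _ _ (circlePow q n))

variable {q}

theorem mem_degreePart {n : ℤ} {u : QSphere 2 q} :
    u ∈ degreePart q n ↔ sphereCoaction q u = circlePow q n ⊗ₜ[ℂ] u := Iff.rfl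

theorem mem_degreePart_zero {u : QSphere 2 q} :
    u ∈ degreePart q 0 ↔ u ∈ invariants (sphereCoaction q) := by
  rw [mem_degreePart, mem_invariants, circlePow_zero]

theorem mul_mem_degreePart {m n : ℤ} {u w : QSphere 2 q} (hu : u ∈ degreePart q m)
    (hw : w ∈ degreePart q n) : u * w ∈ degreePart q (m + n) := by
  rw [mem_degreePart] at *
  rw [map_mul, hu, hw, Algebra.TensorProduct.tmul_mul_tmul, circlePow_add]

theorem x_mem_degreePart (i : Fin 2) : QSphere.x q i ∈ degreePart q 1 := by
  rw [mem_degreePart, sphereCoaction_x, circlePow_one]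

theorem v_mem_degreePart (i : Fin 2) : QSphere.v q i ∈ degreePart q (-1) := by
  rw [mem_degreePart, sphereCoaction_v, circlePow_neg_one]

theorem pow_le_degreePart {Y : Submodule ℂ (QSphere 2 q)} {m : ℤ} (h : Y ≤ degreePart q m)
    (n : ℕ) : Y ^ n ≤ degreePart q (n * m) := by
  induction n with
  | zero =>
    rw [pow_zero, Submodule.one_le]
    simp [mem_degreePart, Algebra.TensorProduct.one_def]
  | succ n ih =>
    rw [pow_succ, Submodule.mul_le]
    intro a ha b hb
    have := mul_mem_degreePart (ih ha) (h hb)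
    rwa [show (n : ℤ) * m + m = ((n + 1 : ℕ) : ℤ) * m by push_cast; ring] at this

/-! ### The subalgebra of the products vⁱxⱼ and the invariants -/

variable (q)

/-- The generators of the invariants of `S_q^3`. -/
def baseGens : Set (QSphere 2 q) :=
  {QSphere.v q 0 * QSphere.x q 0, QSphere.v q 0 * QSphere.x q 1, QSphere.v q 1 * QSphere.x q 0}

/-- The subalgebra generated by the products `vⁱ xⱼ`. -/
def baseSubalgebra : Subalgebra ℂ (QSphere 2 q) := Algebra.adjoin ℂ (baseGens q)

/-- The span of the covector generators. -/
def xSpan : Submodule ℂ (QSphere 2 q) := Submodule.span ℂ (Set.range (QSphere.x q))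

/-- The span of the vector generators. -/
def vSpan : Submodule ℂ (QSphere 2 q) := Submodule.span ℂ (Set.range (QSphere.v q))

variable {q}

theorem x_mem_xSpan (i : Fin 2) : QSphere.x q i ∈ xSpan q := Submodule.subset_span ⟨i, rfl⟩

theorem v_mem_vSpan (i : Fin 2) : QSphere.v q i ∈ vSpan q := Submodule.subset_span ⟨i, rfl⟩

theorem xSpan_le_degreePart : xSpan q ≤ degreePart q 1 :=
  Submodule.span_le.2 (by rintro _ ⟨i, rfl⟩; exact x_mem_degreePart i)

theorem vSpan_le_degreePart : vSpan q ≤ degreePart q (-1) :=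
  Submodule.span_le.2 (by rintro _ ⟨i, rfl⟩; exact v_mem_degreePart i)

theorem v_mul_x_mem_base (i j : Fin 2) :
    QSphere.v q i * QSphere.x q j ∈ baseSubalgebra q := by
  have h00 : QSphere.v q 0 * QSphere.x q 0 ∈ baseSubalgebra q :=
    Algebra.subset_adjoin (by simp [baseGens])
  have h01 : QSphere.v q 0 * QSphere.x q 1 ∈ baseSubalgebra q :=
    Algebra.subset_adjoin (by simp [baseGens])
  have h10 : QSphere.v q 1 * QSphere.x q 0 ∈ baseSubalgebra q :=
    Algebra.subset_adjoin (by simp [baseGens])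
  fin_cases i <;> fin_cases j
  · exact h00
  · exact h01
  · exact h10
  · change QSphere.v q 1 * QSphere.x q 1 ∈ _
    -- The fourth product is left out of the generating set because the norm relation expresses it
    -- through v⁰x₀.
    rw [QSphere.v_one_mul_x_one]
    exact sub_mem (one_mem _) (Subalgebra.smul_mem _ h00 _)

theorem x_mul_v_mem_base (i j : Fin 2) :
    QSphere.x q i * QSphere.v q j ∈ baseSubalgebra q := by
  fin_cases i <;> fin_cases j
  · change QSphere.x q 0 * QSphere.v q 0 ∈ _
    rw [QSphere.x_zero_mul_v_zero]
    exact v_mul_x_mem_base 0 0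
  · change QSphere.x q 0 * QSphere.v q 1 ∈ _
    rw [QSphere.x_zero_mul_v_one]
    exact Subalgebra.smul_mem _ (v_mul_x_mem_base 1 0) _
  · change QSphere.x q 1 * QSphere.v q 0 ∈ _
    rw [QSphere.x_one_mul_v_zero]
    exact Subalgebra.smul_mem _ (v_mul_x_mem_base 0 1) _
  · change QSphere.x q 1 * QSphere.v q 1 ∈ _
    rw [QSphere.x_one_mul_v_one]
    exact sub_mem (one_mem _) (v_mul_x_mem_base 0 0)

theorem xSpan_mul_vSpan_le : xSpan q * vSpan q ≤ Subalgebra.toSubmodule (baseSubalgebra q) := by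
  rw [xSpan, vSpan, Submodule.span_mul_span, Submodule.span_le]
  rintro _ ⟨_, ⟨i, rfl⟩, _, ⟨j, rfl⟩, rfl⟩
  exact x_mul_v_mem_base i j

theorem vSpan_mul_xSpan_le : vSpan q * xSpan q ≤ Subalgebra.toSubmodule (baseSubalgebra q) := by
  rw [xSpan, vSpan, Submodule.span_mul_span, Submodule.span_le]
  rintro _ ⟨_, ⟨i, rfl⟩, _, ⟨j, rfl⟩, rfl⟩
  exact v_mul_x_mem_base i j

theorem baseGens_subset_vx : baseGens q ⊆ (vSpan q * xSpan q : Submodule ℂ (QSphere 2 q)) := by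
  rintro _ (rfl | rfl | rfl) <;> exact Submodule.mul_mem_mul (v_mem_vSpan _) (x_mem_xSpan _)

/-- Writing the generators with x on the left lets the v's move past the subalgebra, by v(xv) =
(vx)v. The exchange rules can be reversed because q is invertible. -/
theorem baseGens_subset_xv : baseGens q ⊆ (xSpan q * vSpan q : Submodule ℂ (QSphere 2 q)) := by
  have hq : (q : ℂ) ≠ 0 := by exact_mod_cast NeZero.ne q
  have h : ∀ i j, QSphere.x q i * QSphere.v q j ∈ xSpan q * vSpan q := fun i j =>
    Submodule.mul_mem_mul (x_mem_xSpan _) (v_mem_vSpan _)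
  rintro _ (rfl | rfl | rfl)
  · rw [← QSphere.x_zero_mul_v_zero]; exact h _ _
  · rw [← inv_smul_smul₀ hq (QSphere.v q 0 * QSphere.x q 1), ← QSphere.x_one_mul_v_zero]
    exact Submodule.smul_mem _ _ (h _ _)
  · rw [← inv_smul_smul₀ hq (QSphere.v q 1 * QSphere.x q 0), ← QSphere.x_zero_mul_v_one]
    exact Submodule.smul_mem _ _ (h _ _)

theorem iSup_base_mul_pow_eq_top :
    ⨆ n : ℕ, (Subalgebra.toSubmodule (baseSubalgebra q) * xSpan q ^ n ⊔
      Subalgebra.toSubmodule (baseSubalgebra q) * vSpan q ^ n) = ⊤ := by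
  refine iSup_toSubmodule_mul_pow_eq_top rfl baseGens_subset_vx baseGens_subset_xv
    xSpan_mul_vSpan_le vSpan_mul_xSpan_le ?_
  rw [eq_top_iff, ← QSphere.adjoin_gens]
  refine Algebra.adjoin_mono ?_
  rintro _ (⟨i, rfl⟩ | ⟨i, rfl⟩)
  · exact Or.inr (v_mem_vSpan i)
  · exact Or.inl (x_mem_xSpan i)

theorem base_le_invariants : baseSubalgebra q ≤ invariants (sphereCoaction q) := by
  have h : ∀ i j, QSphere.v q i * QSphere.x q j ∈ invariants (sphereCoaction q) := fun i j => by
    rw [← mem_degreePart_zero, ← neg_add_cancel 1]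
    exact mul_mem_degreePart (v_mem_degreePart i) (x_mem_degreePart j)
  refine Algebra.adjoin_le ?_
  rintro _ (rfl | rfl | rfl)
  exacts [h 0 0, h 0 1, h 1 0]

theorem base_mul_pow_le_degreePart {Y : Submodule ℂ (QSphere 2 q)} {m : ℤ}
    (h : Y ≤ degreePart q m) (n : ℕ) :
    Subalgebra.toSubmodule (baseSubalgebra q) * Y ^ n ≤ degreePart q (n * m) := by
  rw [Submodule.mul_le]
  intro a ha b hb
  have := mul_mem_degreePart (mem_degreePart_zero.2 (base_le_invariants ha))
    (pow_le_degreePart h n hb)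
  rwa [zero_add] at this

/-- The pieces CXⁿ and CVⁿ, which already span, are homogeneous of degrees n and -n. -/
theorem iSup_degreePart_eq_top : ⨆ n, degreePart q n = ⊤ := by
  rw [eq_top_iff, ← iSup_base_mul_pow_eq_top]
  refine iSup_le fun n => sup_le ?_ ?_
  · exact (base_mul_pow_le_degreePart xSpan_le_degreePart n).trans (le_iSup _ _)
  · exact (base_mul_pow_le_degreePart vSpan_le_degreePart n).trans (le_iSup _ _)

variable (q) in
/-- The projection onto the elements of degree `0`. -/
def degreeZeroProj : QSphere 2 q →ₗ[ℂ] QSphere 2 q :=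
  (TensorProduct.lid ℂ (QSphere 2 q)).toLinearMap ∘ₗ
    (laurentLinear (fun n => if n = 0 then (1 : ℂ) else 0) ∘ₗ
      (circleAlgEquiv q).toLinearMap).rTensor (QSphere 2 q) ∘ₗ (sphereCoaction q).toLinearMap

/-- On degree n the circle factor of the coaction is zⁿ, and the map reads off its constant
coefficient. -/
theorem degreeZeroProj_apply {n : ℤ} {u : QSphere 2 q} (hu : u ∈ degreePart q n) :
    degreeZeroProj q u = if n = 0 then u else 0 := by
  rw [mem_degreePart] at hu
  simp [degreeZeroProj, hu]

/-- The invariants of `S_q^3` are generated by the products `vⁱ xⱼ`. -/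
theorem invariants_eq_base : invariants (sphereCoaction q) = baseSubalgebra q := by
  refine le_antisymm (fun u hu => ?_) base_le_invariants
  -- The projection kills CXⁿ and CVⁿ for n > 0 and fixes C, so its image lies in C; it also fixes
  -- every invariant.
  have h : ∀ w, degreeZeroProj q w ∈ baseSubalgebra q := by
    have key : ∀ {Y : Submodule ℂ (QSphere 2 q)} {m : ℤ}, Y ≤ degreePart q m → m ≠ 0 → ∀ n : ℕ,
        Subalgebra.toSubmodule (baseSubalgebra q) * Y ^ n ≤
          (Subalgebra.toSubmodule (baseSubalgebra q)).comap (degreeZeroProj q) := by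
      intro Y m hY hm n y hy
      rw [Submodule.mem_comap, degreeZeroProj_apply (base_mul_pow_le_degreePart hY n hy)]
      split_ifs with h
      · have : n = 0 := by simpa [hm] using h
        subst this
        simpa using hy
      · exact Submodule.zero_mem _
    intro w
    have hw : w ∈ (⊤ : Submodule ℂ (QSphere 2 q)) := trivial
    rw [← iSup_base_mul_pow_eq_top] at hw
    have hle : _ ≤ (Subalgebra.toSubmodule (baseSubalgebra q)).comap (degreeZeroProj q) :=
      iSup_le fun n => sup_le (key (xSpan_le_degreePart (q := q)) one_ne_zero n)
        (key (vSpan_le_degreePart (q := q)) (by norm_num) n)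
    exact hle hw
  have := h u
  rwa [degreeZeroProj_apply (mem_degreePart_zero.2 hu), if_pos rfl] at this

/-! ### The principal bundle -/

/-- The span of the tensors `u ⊗ w` with `u` of degree `n` and `w` of degree `-n`. -/
def antidiagonalPart (q : ℝ) [NeZero q] (n : ℤ) : Submodule ℂ (QSphere 2 q ⊗[ℂ] QSphere 2 q) :=
  Submodule.span ℂ {ω | ∃ u ∈ degreePart q n, ∃ w ∈ degreePart q (-n), ω = u ⊗ₜ[ℂ] w}

/-- Wrapping a tensor as g · ω · h on its outer sides shifts the two degrees oppositely; this is the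
induction step for the connection. -/
theorem map_mul_mem_antidiagonalPart {m n : ℤ} {g h : QSphere 2 q} (hg : g ∈ degreePart q m)
    (hh : h ∈ degreePart q (-m)) {ω : QSphere 2 q ⊗[ℂ] QSphere 2 q}
    (hω : ω ∈ antidiagonalPart q n) :
    TensorProduct.map (LinearMap.mulLeft ℂ g) (LinearMap.mulRight ℂ h) ω ∈
      antidiagonalPart q (m + n) := by
  unfold antidiagonalPart at hω
  induction hω using Submodule.span_induction with
  | mem x hx =>
    obtain ⟨u, hu, w, hw, rfl⟩ := hx
    refine Submodule.subset_span ⟨g * u, mul_mem_degreePart hg hu, w * h, ?_, rfl⟩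
    rw [show -(m + n) = -n + -m by ring]
    exact mul_mem_degreePart hw hh
  | zero => rw [map_zero]; exact Submodule.zero_mem _
  | add x y _ _ hx hy => rw [map_add]; exact Submodule.add_mem _ hx hy
  | smul a x _ hx => rw [map_smul]; exact Submodule.smul_mem _ _ hx

theorem mul'_map_mul {A : Type*} [Ring A] [Algebra ℂ A] (g h : A) (ω : A ⊗[ℂ] A) :
    LinearMap.mul' ℂ A (TensorProduct.map (LinearMap.mulLeft ℂ g) (LinearMap.mulRight ℂ h) ω) =
      g * LinearMap.mul' ℂ A ω * h := by
  induction ω with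
  | zero => simp
  | add u v hu hv => simp [mul_add, add_mul, hu, hv]
  | tmul u v => simp [mul_assoc]

/-- If ω has product 1, then x₀ωv⁰ + x₁ωv¹ has product x₀v⁰ + x₁v¹ = 1. -/
theorem exists_connection_nat (n : ℕ) :
    ∃ ω ∈ antidiagonalPart q n, LinearMap.mul' ℂ (QSphere 2 q) ω = 1 := by
  induction n with
  | zero =>
    refine ⟨1 ⊗ₜ 1, Submodule.subset_span ⟨1, ?_, 1, ?_, rfl⟩, by simp⟩ <;>
      simp [mem_degreePart, Algebra.TensorProduct.one_def]
  | succ n ih =>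
    obtain ⟨ω, hω, h1⟩ := ih
    have h := add_mem
      (map_mul_mem_antidiagonalPart (x_mem_degreePart 0) (v_mem_degreePart 0) hω)
      (map_mul_mem_antidiagonalPart (x_mem_degreePart 1) (v_mem_degreePart 1) hω)
    rw [show 1 + (n : ℤ) = ((n + 1 : ℕ) : ℤ) by push_cast; ring] at h
    refine ⟨_, h, ?_⟩
    rw [map_add, mul'_map_mul, mul'_map_mul, h1, mul_one, mul_one, QSphere.x_zero_mul_v_zero,
        QSphere.x_one_mul_v_one, add_sub_cancel]

/-- The same nesting with v outside on the left; the weight q⁻² on the index 0 is the one in the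
norm relation. -/
theorem exists_connection_neg (n : ℕ) :
    ∃ ω ∈ antidiagonalPart q (-n), LinearMap.mul' ℂ (QSphere 2 q) ω = 1 := by
  induction n with
  | zero => simpa using exists_connection_nat (q := q) 0
  | succ n ih =>
    obtain ⟨ω, hω, h1⟩ := ih
    have hx : ∀ i, QSphere.x q i ∈ degreePart q (- -1) := fun i => by
      rw [neg_neg]; exact x_mem_degreePart i
    have h := add_mem (Submodule.smul_mem _ ((q : ℂ)⁻¹ ^ 2)
      (map_mul_mem_antidiagonalPart (v_mem_degreePart 0) (hx 0) hω))
      (map_mul_mem_antidiagonalPart (v_mem_degreePart 1) (hx 1) hω)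
    rw [show -1 + -(n : ℤ) = -((n + 1 : ℕ) : ℤ) by push_cast; ring] at h
    refine ⟨_, h, ?_⟩
    rw [map_add, map_smul, mul'_map_mul, mul'_map_mul, h1, mul_one, mul_one,
        QSphere.v_one_mul_x_one, add_sub_cancel]

theorem exists_connection (n : ℤ) :
    ∃ ω ∈ antidiagonalPart q n, LinearMap.mul' ℂ (QSphere 2 q) ω = 1 := by
  obtain ⟨m, rfl | rfl⟩ := n.eq_nat_or_neg
  · exact exists_connection_nat m
  · exact exists_connection_neg m

variable (q) in
/-- A tensor in `P_n ⊗ P_{-n}` with product `1`. -/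
def connection (n : ℤ) : QSphere 2 q ⊗[ℂ] QSphere 2 q := (exists_connection (q := q) n).choose

theorem connection_mem (n : ℤ) : connection q n ∈ antidiagonalPart q n :=
  (exists_connection (q := q) n).choose_spec.1

theorem mul'_connection (n : ℤ) : LinearMap.mul' ℂ (QSphere 2 q) (connection q n) = 1 :=
  (exists_connection (q := q) n).choose_spec.2

/-! ### Freeness and exactness of the canonical map -/

theorem canonicalMap_mul_right {H P : Type*} [Ring H] [HopfAlgebra ℂ H] [Ring P] [Algebra ℂ P]
    (β : P →ₐ[ℂ] H ⊗[ℂ] P) (ω : P ⊗[ℂ] P) (p : P) :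
    canonicalMap β (ω * 1 ⊗ₜ[ℂ] p) = canonicalMap β ω * 1 ⊗ₜ[ℂ] p := by
  induction ω with
  | zero => simp
  | add u v hu hv => simp only [add_mul, map_add, hu, hv]
  | tmul u v => simp [canonicalMap_tmul, mul_assoc]

/-- The canonical map sees only the degree of the left factor and the product, so a connection
tensor goes to zⁿ ⊗ 1. -/
theorem canonicalMap_antidiagonalPart {n : ℤ} {ω : QSphere 2 q ⊗[ℂ] QSphere 2 q}
    (hω : ω ∈ antidiagonalPart q n) : canonicalMap (sphereCoaction q) ω =
      circlePow q n ⊗ₜ[ℂ] LinearMap.mul' ℂ (QSphere 2 q) ω := by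
  unfold antidiagonalPart at hω
  induction hω using Submodule.span_induction with
  | mem x hx =>
    obtain ⟨u, hu, w, hw, rfl⟩ := hx
    rw [canonicalMap_tmul, mem_degreePart.1 hu]
    simp
  | zero => simp
  | add x y _ _ hx hy => rw [map_add, map_add, hx, hy, TensorProduct.tmul_add]
  | smul a x _ hx => rw [map_smul, map_smul, hx, TensorProduct.tmul_smul]

theorem canonicalMap_connection (n : ℤ) (p : QSphere 2 q) :
    canonicalMap (sphereCoaction q) (connection q n * 1 ⊗ₜ[ℂ] p) = circlePow q n ⊗ₜ[ℂ] p := by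
  rw [canonicalMap_mul_right, canonicalMap_antidiagonalPart (connection_mem n), mul'_connection]
  simp

theorem canonicalMap_surjective : Function.Surjective (canonicalMap (sphereCoaction q)) := by
  intro ω
  induction ω with
  | zero => exact ⟨0, map_zero _⟩
  | add u v hu hv =>
    obtain ⟨u', rfl⟩ := hu
    obtain ⟨v', rfl⟩ := hv
    exact ⟨u' + v', map_add _ _ _⟩
  | tmul a p =>
    exact circle_induction q (N := (LinearMap.range (canonicalMap (sphereCoaction q))).comap
      ((TensorProduct.mk ℂ _ _).flip p)) (fun n => ⟨_, canonicalMap_connection n p⟩) a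

variable (q) in
/-- A linear section of the canonical map. -/
def translation : QSphere 1 q ⊗[ℂ] QSphere 2 q →ₗ[ℂ] QSphere 2 q ⊗[ℂ] QSphere 2 q :=
  TensorProduct.lift (laurentLinear (fun n => LinearMap.mulLeft ℂ (connection q n) ∘ₗ
    (Algebra.TensorProduct.includeRight : QSphere 2 q →ₐ[ℂ] _).toLinearMap) ∘ₗ
      (circleAlgEquiv q).toLinearMap)

theorem translation_tmul (n : ℤ) (p : QSphere 2 q) :
    translation q (circlePow q n ⊗ₜ[ℂ] p) = connection q n * 1 ⊗ₜ[ℂ] p := by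
  simp [translation]

theorem tmul_sub_tmul_mem_horizontalForms {P : Type*} [Ring P] [Algebra ℂ P] {B : Subalgebra ℂ P}
    {b : P} (hb : b ∈ B) (u w : P) :
    (u * b) ⊗ₜ[ℂ] w - u ⊗ₜ[ℂ] (b * w) ∈ horizontalForms B := by
  have : (u * b) ⊗ₜ[ℂ] w - u ⊗ₜ[ℂ] (b * w) =
      -(u ⊗ₜ[ℂ] 1 * (1 ⊗ₜ[ℂ] b - b ⊗ₜ[ℂ] 1) * 1 ⊗ₜ[ℂ] w) := by
    simp [mul_sub, sub_mul]
  rw [this]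
  exact Submodule.neg_mem _ (Submodule.subset_span ⟨u, w, b, hb, rfl⟩)

/-- For ω = a ⊗ c the product cu has degree -n + n = 0, so it is invariant and acu ⊗ w agrees with a
⊗ cuw modulo horizontal forms. -/
theorem mul'_mul_tmul_sub_mem_horizontalForms {n : ℤ} {ω : QSphere 2 q ⊗[ℂ] QSphere 2 q}
    (hω : ω ∈ antidiagonalPart q n) {u : QSphere 2 q} (hu : u ∈ degreePart q n)
    (w : QSphere 2 q) :
    (LinearMap.mul' ℂ (QSphere 2 q) ω * u) ⊗ₜ[ℂ] w - ω * 1 ⊗ₜ[ℂ] (u * w) ∈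
      horizontalForms (invariants (sphereCoaction q)) := by
  unfold antidiagonalPart at hω
  induction hω using Submodule.span_induction with
  | mem x hx =>
    obtain ⟨a, ha, c, hc, rfl⟩ := hx
    have hcu : c * u ∈ invariants (sphereCoaction q) := by
      rw [← mem_degreePart_zero, ← neg_add_cancel n]
      exact mul_mem_degreePart hc hu
    simpa [mul_assoc] using tmul_sub_tmul_mem_horizontalForms hcu a w
  | zero => simp
  | add x y _ _ hx hy =>
    rw [map_add, add_mul, add_mul, TensorProduct.add_tmul, add_sub_add_comm]
    exact add_mem hx hy
  | smul a x _ hx =>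
    rw [map_smul, smul_mul_assoc, smul_mul_assoc, ← TensorProduct.smul_tmul', ← smul_sub]
    exact Submodule.smul_mem _ _ hx

/-- The homogeneous parts span, so u may be taken of degree n. Its image under χ and the section is
ωₙ(1 ⊗ uw), and `mul'_mul_tmul_sub_mem_horizontalForms` applies with ωₙ of product 1. -/
theorem sub_translation_mem_horizontalForms (ω : QSphere 2 q ⊗[ℂ] QSphere 2 q) :
    ω - translation q (canonicalMap (sphereCoaction q) ω) ∈
      horizontalForms (invariants (sphereCoaction q)) := by
  induction ω with
  | zero => simp
  | add u v hu hv =>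
    rw [map_add, map_add, add_sub_add_comm]
    exact add_mem hu hv
  | tmul u w =>
    let N : Submodule ℂ (QSphere 2 q) := (horizontalForms (invariants (sphereCoaction q))).comap
      ((LinearMap.id - translation q ∘ₗ canonicalMap (sphereCoaction q)) ∘ₗ
        (TensorProduct.mk ℂ _ _).flip w)
    have hN : ⨆ n, degreePart q n ≤ N := by
      refine iSup_le fun n u hu => ?_
      change u ⊗ₜ[ℂ] w - translation q (canonicalMap (sphereCoaction q) (u ⊗ₜ[ℂ] w)) ∈
        horizontalForms (invariants (sphereCoaction q))
      rw [canonicalMap_tmul, mem_degreePart.1 hu, Algebra.TensorProduct.tmul_mul_tmul, mul_one,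
        translation_tmul]
      have := mul'_mul_tmul_sub_mem_horizontalForms (connection_mem n) hu w
      rwa [mul'_connection, one_mul] at this
    exact hN (by rw [iSup_degreePart_eq_top]; trivial)

/-- For invariant b one has β(ub) = β(u)(1 ⊗ b), so u ⊗ bw and ub ⊗ w have the same image. -/
theorem canonicalMap_horizontalForms {H P : Type*} [Ring H] [HopfAlgebra ℂ H] [Ring P]
    [Algebra ℂ P] (β : P →ₐ[ℂ] H ⊗[ℂ] P) {ω : P ⊗[ℂ] P}
    (hω : ω ∈ horizontalForms (invariants β)) : canonicalMap β ω = 0 := by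
  unfold horizontalForms at hω
  induction hω using Submodule.span_induction with
  | mem x hx =>
    obtain ⟨u, w, b, hb, rfl⟩ := hx
    rw [mem_invariants] at hb
    simp [mul_sub, sub_mul, canonicalMap_tmul, hb, mul_assoc]
  | zero => simp
  | add x y _ _ hx hy => rw [map_add, hx, hy, add_zero]
  | smul a x _ hx => rw [map_smul, hx, smul_zero]

theorem sphereCoaction_isQuantumPrincipalBundle :
    IsQuantumPrincipalBundle (sphereCoaction q) where
  comoduleAlgebra := sphereCoaction_isLeftComoduleAlgebra q
  free := canonicalMap_surjective
  exact ω _ := by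
    refine ⟨fun h => ?_, canonicalMap_horizontalForms _⟩
    have := sub_translation_mem_horizontalForms ω
    rwa [h, map_zero, sub_zero] at this

end

section
variable (q : ℝ) [NeZero q]

/-! ### The map from the Podleś sphere to `S_q^3` -/

/-- The images of the generators of the Podleś sphere in `S_q^3`. -/
def podlesImage : PodlesGen → QSphere 2 q
  | .A => (q : ℂ)⁻¹ ^ 2 • (QSphere.v q 0 * QSphere.x q 0)
  | .B => QSphere.v q 0 * QSphere.x q 1
  | .Bstar => QSphere.v q 1 * QSphere.x q 0

/-- The factor q⁻² in the image of A is dictated by B⋆B = A - A²: reordering v¹x₀v⁰x₁ gives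
q⁻²v⁰(v¹x₁)x₀, and the norm relation equates v¹x₁ with 1 - q⁻²v⁰x₀. -/
theorem podlesImage_relations :
    podlesImage q .Bstar * podlesImage q .B = podlesImage q .A - podlesImage q .A ^ 2 ∧
    podlesImage q .B * podlesImage q .Bstar =
      (q : ℂ) ^ 2 • podlesImage q .A - (q : ℂ) ^ 4 • podlesImage q .A ^ 2 ∧
    podlesImage q .B * podlesImage q .A = (q : ℂ) ^ 2 • (podlesImage q .A * podlesImage q .B) ∧
    podlesImage q .A * podlesImage q .Bstar =
      (q : ℂ) ^ 2 • (podlesImage q .Bstar * podlesImage q .A) := by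
  have hq : (q : ℂ) ≠ 0 := by exact_mod_cast NeZero.ne q
  have r1 := QSphere.v_one_mul_v_zero (q := q)
  have r2 := QSphere.x_one_mul_x_zero (q := q)
  have r3 := QSphere.x_zero_mul_v_zero (q := q)
  -- This exchange rule is used backwards, so that v¹ moves right until it meets x₁ and both are
  -- eliminated by the norm relations.
  have r4 : QSphere.v q 1 * QSphere.x q 0 = (q : ℂ)⁻¹ • (QSphere.x (n := 2) q 0 * QSphere.v q 1) := by
    rw [QSphere.x_zero_mul_v_one, inv_smul_smul₀ hq]
  have r5 := QSphere.x_one_mul_v_zero (q := q)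
  have r6 := QSphere.v_one_mul_x_one (q := q)
  have r7 := QSphere.x_one_mul_v_one (q := q)
  simp only [podlesImage]
  generalize QSphere.v (n := 2) q 0 = a at *
  generalize QSphere.v (n := 2) q 1 = b at *
  generalize QSphere.x (n := 2) q 0 = c at *
  generalize QSphere.x (n := 2) q 1 = d at *
  generalize (q : ℂ) = k at *
  -- The same rules with a tail z apply inside right-associated products.
  have s1 : ∀ z, b * (a * z) = k⁻¹ • (a * (b * z)) := fun z => by
    rw [← mul_assoc, r1, smul_mul_assoc, mul_assoc]
  have s2 : ∀ z, d * (c * z) = k • (c * (d * z)) := fun z => by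
    rw [← mul_assoc, r2, smul_mul_assoc, mul_assoc]
  have s3 : ∀ z, c * (a * z) = a * (c * z) := fun z => by
    rw [← mul_assoc, r3, mul_assoc]
  have s5 : ∀ z, d * (a * z) = k • (a * (d * z)) := fun z => by
    rw [← mul_assoc, r5, smul_mul_assoc, mul_assoc]
  refine ⟨?_, ?_, ?_, ?_⟩ <;>
    simp only [mul_assoc, smul_mul_assoc, mul_smul_comm, r2, r3, r4, r6, r7, s1, s2, s3,
      s5, mul_sub, mul_one, pow_two (_ • _)] <;>
    match_scalars <;> field_simp

/-- The map from the Podleś sphere to `S_q^3`. -/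
def podlesHom : Podles q →ₐ[ℂ] QSphere 2 q :=
  Podles.lift (podlesImage q) (podlesImage_relations q).1 (podlesImage_relations q).2.1
    (podlesImage_relations q).2.2.1 (podlesImage_relations q).2.2.2

@[simp] theorem podlesHom_gen (g : PodlesGen) :
    podlesHom q (Podles.gen q g) = podlesImage q g := Podles.lift_gen _ _ _ _ _ _

theorem adjoin_podlesGen : Algebra.adjoin ℂ (Set.range (Podles.gen q)) = ⊤ :=
  adjoin_ringQuot (PodlesRel q)

theorem podlesHom_star (p : Podles q) : podlesHom q (star p) = star (podlesHom q p) := by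
  refine map_star_of_adjoin (podlesHom q) (adjoin_podlesGen q) ?_ p
  rintro _ ⟨g, rfl⟩
  rw [Podles.star_gen, podlesHom_gen, podlesHom_gen]
  cases g <;> simp [-Complex.coe_smul, Podles.genStar, podlesImage]

theorem podlesHom_mem_invariants (p : Podles q) :
    podlesHom q p ∈ invariants (sphereCoaction q) := by
  have hp : p ∈ Algebra.adjoin ℂ (Set.range (Podles.gen q)) := by
    rw [adjoin_podlesGen]; trivial
  have hle : Algebra.adjoin ℂ (Set.range (Podles.gen q)) ≤
      (baseSubalgebra q).comap (podlesHom q) := by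
    refine Algebra.adjoin_le ?_
    rintro _ ⟨g, rfl⟩
    change podlesHom q _ ∈ baseSubalgebra q
    rw [podlesHom_gen]
    cases g
    · exact Subalgebra.smul_mem _ (v_mul_x_mem_base 0 0) _
    · exact v_mul_x_mem_base 0 1
    · exact v_mul_x_mem_base 1 0
  rw [invariants_eq_base]
  exact hle hp

theorem invariants_le_range_podlesHom :
    invariants (sphereCoaction q) ≤ (podlesHom q).range := by
  have hq : (q : ℂ) ≠ 0 := by exact_mod_cast NeZero.ne q
  rw [invariants_eq_base]
  refine Algebra.adjoin_le ?_
  rintro _ (rfl | rfl | rfl)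
  · refine ⟨(q : ℂ) ^ 2 • Podles.gen q .A, ?_⟩
    simp [-Complex.coe_smul, podlesImage, smul_smul, hq]
  · exact ⟨_, podlesHom_gen q .B⟩
  · exact ⟨_, podlesHom_gen q .Bstar⟩

/-! ### A representation of `S_q^3` on sequences of polynomials -/

open Polynomial

/-- The weighted shift operator `(f n) ↦ (w n * f (n + k))` on sequences of polynomials. -/
def weightedShift (k : ℤ) (w : ℤ → ℂ[X]) : Module.End ℂ (ℤ → ℂ[X]) where
  toFun f n := w n * f (n + k)
  map_add' f g := by ext1 n; simp [mul_add]
  map_smul' c f := by ext1 n; simp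

@[simp] theorem weightedShift_apply (k : ℤ) (w : ℤ → ℂ[X]) (f : ℤ → ℂ[X]) (n : ℤ) :
    weightedShift k w f n = w n * f (n + k) := rfl

theorem weightedShift_single (k : ℤ) (w : ℤ → ℂ[X]) (m : ℤ) (h : ℂ[X]) :
    weightedShift k w (Pi.single m h) = Pi.single (m - k) (w (m - k) * h) := by
  ext1 n
  rw [weightedShift_apply]
  by_cases hn : n = m - k
  · subst hn; simp
  · rw [Pi.single_eq_of_ne hn, Pi.single_eq_of_ne (by omega), mul_zero]

/-- The action of the matrix of generators of `SU_q(2)` on sequences of polynomials. -/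
theorem isQMat_weightedShift : SUq.IsQMat q (weightedShift 1 1)
    (weightedShift 0 fun n => C ((q : ℂ) ^ (-n)) * X)
    (weightedShift 0 fun n => C ((q : ℂ) ^ (-n)))
    (weightedShift (-1) fun n => 1 + C ((q : ℂ) ^ (1 - 2 * n)) * X) := by
  -- Here a is the plain shift, and b, c are diagonal with bc = q⁻²ⁿX. The weight of d is forced by
  -- da = 1 + q bc, and `ad` holds because the weight is then evaluated at n + 1. The identities e0,
  -- e1, e2 express all powers of q through q⁻ⁿ, leaving commutative algebra at each position.
  have hq : (q : ℂ) ≠ 0 := by exact_mod_cast NeZero.ne q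
  have e0 : ∀ n : ℤ, (q : ℂ) ^ (1 - 2 * n) = q * (q : ℂ) ^ (-n) * (q : ℂ) ^ (-n) := fun n => by
    rw [← zpow_one_add₀ hq, ← zpow_add₀ hq]; congr 1; ring
  have e1 : ∀ n : ℤ, (q : ℂ) ^ (-(n + 1)) = (q : ℂ)⁻¹ * (q : ℂ) ^ (-n) := fun n => by
    rw [← zpow_neg_one, ← zpow_add₀ hq]; congr 1; ring
  have e2 : ∀ n : ℤ, (q : ℂ) ^ (-(n + -1)) = (q : ℂ) * (q : ℂ) ^ (-n) := fun n => by
    rw [← zpow_one_add₀ hq]; congr 1; ring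
  have hC : (C (q : ℂ)) * C ((q : ℂ)⁻¹) = 1 := by rw [← C_mul, mul_inv_cancel₀ hq, C_1]
  constructor <;>
  · refine LinearMap.ext fun f => funext fun n => ?_
    simp only [Module.End.mul_apply, LinearMap.add_apply, LinearMap.smul_apply, Pi.add_apply,
      Pi.smul_apply, Module.End.one_apply, weightedShift_apply, Pi.one_apply, e0, e1, e2, add_zero,
      neg_add_cancel_right, add_neg_cancel_right, smul_eq_C_mul, C_mul]
    generalize C (q : ℂ) = k at *
    generalize C (q : ℂ)⁻¹ = k' at *
    grind

/-- The representation of `S_q^3` by weighted shifts. -/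
def shiftRep : QSphere 2 q →ₐ[ℂ] Module.End ℂ (ℤ → ℂ[X]) :=
  QSphere.lift₂
    ![-((q : ℂ) • weightedShift 0 fun n => C ((q : ℂ) ^ (-n)) * X), weightedShift 1 1]
    ![weightedShift 0 fun n => C ((q : ℂ) ^ (-n)),
      weightedShift (-1) fun n => 1 + C ((q : ℂ) ^ (1 - 2 * n)) * X] (by
    have hq : (q : ℂ) ≠ 0 := by exact_mod_cast NeZero.ne q
    simpa [-Complex.coe_smul, smul_smul, hq] using isQMat_weightedShift q)

theorem shiftRep_A (f : ℤ → ℂ[X]) (n : ℤ) : shiftRep q (podlesHom q (Podles.gen q .A)) f n =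
    C (-((q : ℂ) ^ (-1 - 2 * n))) * X * f n := by
  have hq : (q : ℂ) ≠ 0 := by exact_mod_cast NeZero.ne q
  have e : (q : ℂ) ^ (-1 - 2 * n) = (q : ℂ)⁻¹ ^ 2 * (q * ((q : ℂ) ^ (-n) * (q : ℂ) ^ (-n))) := by
    rw [← zpow_add₀ hq, ← zpow_one_add₀ hq, ← zpow_natCast, inv_zpow', ← zpow_add₀ hq]
    congr 1; push_cast; ring
  rw [e]
  simp [-Complex.coe_smul, shiftRep, podlesImage, smul_eq_C_mul]
  ring

/-- With `shiftRep_Bstar_single`: B moves a sequence supported at one position one step up and B⋆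
one step down, and neither kills it, since the weights are nonzero polynomials and ℂ[X] is a domain.
-/
theorem shiftRep_B_single (m : ℤ) (h : ℂ[X]) (hh : h ≠ 0) : ∃ h' ≠ 0,
    shiftRep q (podlesHom q (Podles.gen q .B)) (Pi.single m h) = Pi.single (m + 1) h' := by
  have hq : (q : ℂ) ≠ 0 := by exact_mod_cast NeZero.ne q
  refine ⟨-((q : ℂ) • (C ((q : ℂ) ^ (-(m + 1))) * X *
    ((1 + C ((q : ℂ) ^ (1 - 2 * (m + 1))) * X) * h))), ?_, ?_⟩
  -- The constant term of this weight is 1.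
  · have h1 : (1 + C ((q : ℂ) ^ (1 - 2 * (m + 1))) * X : ℂ[X]) ≠ 0 := fun h0 => by
      have := congrArg (Polynomial.eval 0) h0
      simp at this
    have h2 : (C ((q : ℂ) ^ (-(m + 1))) : ℂ[X]) ≠ 0 := by
      rw [Ne, C_eq_zero]; exact zpow_ne_zero _ hq
    exact neg_ne_zero.2 (smul_ne_zero hq (mul_ne_zero (mul_ne_zero h2 X_ne_zero)
      (mul_ne_zero h1 hh)))
  · rw [podlesHom_gen]
    simp only [podlesImage, map_mul, shiftRep, QSphere.lift₂_v, QSphere.lift₂_x,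
      Module.End.mul_apply, Matrix.cons_val_zero, Matrix.cons_val_one, Matrix.cons_val_fin_one,
      LinearMap.neg_apply, LinearMap.smul_apply, weightedShift_single, sub_neg_eq_add, sub_zero]
    rw [← Pi.single_smul, ← Pi.single_neg]

theorem shiftRep_Bstar_single (m : ℤ) (h : ℂ[X]) (hh : h ≠ 0) : ∃ h' ≠ 0,
    shiftRep q (podlesHom q (Podles.gen q .Bstar)) (Pi.single m h) = Pi.single (m - 1) h' := by
  have hq : (q : ℂ) ≠ 0 := by exact_mod_cast NeZero.ne q
  refine ⟨C ((q : ℂ) ^ (-m)) * h, ?_, ?_⟩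
  · have h2 : (C ((q : ℂ) ^ (-m)) : ℂ[X]) ≠ 0 := by
      rw [Ne, C_eq_zero]; exact zpow_ne_zero _ hq
    exact mul_ne_zero h2 hh
  · rw [podlesHom_gen]
    simp only [podlesImage, map_mul, shiftRep, QSphere.lift₂_v, QSphere.lift₂_x,
      Module.End.mul_apply, Matrix.cons_val_zero, Matrix.cons_val_one, Matrix.cons_val_fin_one,
      weightedShift_single, sub_zero, Pi.one_apply, one_mul]

/-! ### A spanning set of the Podleś sphere -/

/-- The elements `Bⁿ` (for `n ≥ 0`) and `(B⋆)⁻ⁿ` (for `n < 0`) of the Podleś sphere. -/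
def podlesPow (n : ℤ) : Podles q :=
  if 0 ≤ n then Podles.gen q .B ^ n.toNat else Podles.gen q .Bstar ^ (-n).toNat

theorem podlesPow_natCast (n : ℕ) : podlesPow q n = Podles.gen q .B ^ n := by
  simp [podlesPow]

theorem podlesPow_neg_natCast (n : ℕ) : podlesPow q (-n) = Podles.gen q .Bstar ^ n := by
  rcases n with _ | n
  · simp [podlesPow]
  · rw [podlesPow, if_neg (by push_cast; omega)]
    simp

/-- The map `(pₙ) ↦ ∑ pₙ(A) Bⁿ` onto the Podleś sphere. -/
def podlesNormalForm : (ℤ →₀ ℂ[X]) →ₗ[ℂ] Podles q :=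
  Finsupp.lsum ℂ fun n => LinearMap.mulRight ℂ (podlesPow q n) ∘ₗ
    (Polynomial.aeval (Podles.gen q .A)).toLinearMap

@[simp] theorem podlesNormalForm_single (n : ℤ) (p : ℂ[X]) :
    podlesNormalForm q (Finsupp.single n p) =
      Polynomial.aeval (Podles.gen q .A) p * podlesPow q n := by
  simp [podlesNormalForm]

/-- The relation says that g intertwines h with k • h, so g passes p(h) after rescaling the variable
by k. -/
theorem mul_aeval_of_mul_eq_smul {A : Type*} [Ring A] [Algebra ℂ A] {g h : A} {k : ℂ}
    (hgh : g * h = k • (h * g)) (p : ℂ[X]) :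
    g * Polynomial.aeval h p = Polynomial.aeval h (p.comp (C k * X)) * g := by
  induction p using Polynomial.induction_on' with
  | add p q hp hq => simp only [map_add, mul_add, add_mul, Polynomial.add_comp, hp, hq]
  | monomial n c =>
    have h1 : g * h ^ n = (k • h) ^ n * g := by
      have : SemiconjBy g h (k • h) := by rw [SemiconjBy, hgh, smul_mul_assoc]
      exact this.pow_right n
    simp only [Polynomial.monomial_comp, map_mul, map_pow, Polynomial.aeval_monomial,
      Polynomial.aeval_C, Polynomial.aeval_X, ← Algebra.smul_def, mul_smul_comm, h1,
      smul_mul_assoc]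

/-- For n < 0 the leading BB⋆ collapses to a polynomial in A by the Podleś relations; otherwise B
only lengthens the power. -/
theorem B_mul_podlesPow (n : ℤ) : ∃ p : ℂ[X], Podles.gen q .B * podlesPow q n =
    Polynomial.aeval (Podles.gen q .A) p * podlesPow q (n + 1) := by
  obtain ⟨m, rfl | rfl⟩ := n.eq_nat_or_neg
  · refine ⟨1, ?_⟩
    rw [← Nat.cast_succ, podlesPow_natCast, podlesPow_natCast, map_one, one_mul, pow_succ']
  · rcases m with _ | m
    · refine ⟨1, ?_⟩
      have h0 := podlesPow_natCast q 0
      have h1 := podlesPow_natCast q 1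
      simp only [Nat.cast_zero, Nat.cast_one, pow_zero, pow_one] at h0 h1
      simp [h0, h1]
    · refine ⟨C ((q : ℂ) ^ 2) * X - C ((q : ℂ) ^ 4) * X ^ 2, ?_⟩
      rw [show -((m + 1 : ℕ) : ℤ) + 1 = -(m : ℤ) by push_cast; ring, podlesPow_neg_natCast,
        podlesPow_neg_natCast, pow_succ', ← mul_assoc, Podles.B_mul_Bstar]
      simp only [map_sub, map_mul, map_pow, Polynomial.aeval_C, Polynomial.aeval_X,
        Algebra.smul_def]

theorem Bstar_mul_podlesPow (n : ℤ) : ∃ p : ℂ[X], Podles.gen q .Bstar * podlesPow q n =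
    Polynomial.aeval (Podles.gen q .A) p * podlesPow q (n - 1) := by
  obtain ⟨m, rfl | rfl⟩ := n.eq_nat_or_neg
  · rcases m with _ | m
    · refine ⟨1, ?_⟩
      have h0 := podlesPow_natCast q 0
      have h1 := podlesPow_neg_natCast q 1
      simp only [Nat.cast_zero, Nat.cast_one, pow_zero, pow_one] at h0 h1
      simp [h0, h1]
    · refine ⟨X - X ^ 2, ?_⟩
      rw [show ((m + 1 : ℕ) : ℤ) - 1 = (m : ℤ) by push_cast; ring, podlesPow_natCast,
        podlesPow_natCast, pow_succ', ← mul_assoc, Podles.Bstar_mul_B]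
      simp only [map_sub, map_pow, Polynomial.aeval_X]
  · refine ⟨1, ?_⟩
    rw [show -(m : ℤ) - 1 = -((m + 1 : ℕ) : ℤ) by push_cast; ring, podlesPow_neg_natCast,
      podlesPow_neg_natCast, map_one, one_mul, pow_succ']

/-- The combinations of p(A)Bⁿ and p(A)(B⋆)ⁿ contain 1 and are stable under left multiplication by
generators: B and B⋆ pass p(A) by rescaling its variable and are then absorbed into the power. -/
theorem podlesNormalForm_surjective : Function.Surjective (podlesNormalForm q) := by
  have hq : (q : ℂ) ≠ 0 := by exact_mod_cast NeZero.ne q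
  rw [← LinearMap.range_eq_top]
  refine submodule_eq_top_of_mul_left (adjoin_podlesGen q) _ ?_ ?_
  · refine ⟨Finsupp.single 0 1, ?_⟩
    simpa using podlesPow_natCast q 0
  · rintro _ ⟨g, rfl⟩ _ ⟨y, rfl⟩
    induction y using Finsupp.induction_linear with
    | zero => simp
    | add y z hy hz => rw [map_add, mul_add]; exact add_mem hy hz
    | single n p =>
      rw [podlesNormalForm_single, ← mul_assoc]
      cases g with
      | A => exact ⟨Finsupp.single n (X * p), by
        rw [podlesNormalForm_single, map_mul, Polynomial.aeval_X]⟩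
      | B =>
        obtain ⟨r, hr⟩ := B_mul_podlesPow q n
        refine ⟨Finsupp.single (n + 1) (p.comp (C ((q : ℂ) ^ 2) * X) * r), ?_⟩
        rw [podlesNormalForm_single, mul_aeval_of_mul_eq_smul Podles.B_mul_A, mul_assoc, hr,
          map_mul, mul_assoc]
      | Bstar =>
        obtain ⟨r, hr⟩ := Bstar_mul_podlesPow q n
        have h : Podles.gen q .Bstar * Podles.gen q .A =
            ((q : ℂ) ^ 2)⁻¹ • (Podles.gen q .A * Podles.gen q .Bstar) := by
          rw [Podles.A_mul_Bstar, inv_smul_smul₀ (pow_ne_zero 2 hq)]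
        refine ⟨Finsupp.single (n - 1) (p.comp (C (((q : ℂ) ^ 2)⁻¹) * X) * r), ?_⟩
        rw [podlesNormalForm_single, mul_aeval_of_mul_eq_smul h, mul_assoc, hr,
          map_mul, mul_assoc]

/-! ### Injectivity of the map from the Podleś sphere -/

theorem shiftRep_aeval (p : ℂ[X]) (f : ℤ → ℂ[X]) (n : ℤ) :
    shiftRep q (podlesHom q (Polynomial.aeval (Podles.gen q .A) p)) f n =
      p.comp (C (-((q : ℂ) ^ (-1 - 2 * n))) * X) * f n := by
  induction p using Polynomial.induction_on generalizing f with
  | C a => simp [Polynomial.aeval_C, smul_eq_C_mul]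
  | add p q hp hq =>
    simp only [map_add, LinearMap.add_apply, Pi.add_apply, Polynomial.add_comp, add_mul, hp, hq]
  | monomial m a h =>
    rw [pow_succ, ← mul_assoc, map_mul, map_mul, map_mul, Module.End.mul_apply, h,
      Polynomial.aeval_X, shiftRep_A, Polynomial.mul_comp _ X, Polynomial.X_comp, ← mul_assoc]

/-- Applied to the sequence supported at 0, distinct powers land at distinct positions, so the
coefficients of a normal form can be read off separately. -/
theorem exists_shiftRep_podlesPow (n : ℤ) : ∃ h : ℂ[X], h ≠ 0 ∧
    shiftRep q (podlesHom q (podlesPow q n)) (Pi.single 0 1) = Pi.single n h := by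
  obtain ⟨m, rfl | rfl⟩ := n.eq_nat_or_neg
  · rw [podlesPow_natCast]
    induction m with
    | zero => exact ⟨1, one_ne_zero, by simp⟩
    | succ m ih =>
      obtain ⟨h, hh, e⟩ := ih
      obtain ⟨h', hh', e'⟩ := shiftRep_B_single q m h hh
      refine ⟨h', hh', ?_⟩
      rw [pow_succ', map_mul, map_mul, Module.End.mul_apply, e, e', Nat.cast_succ]
  · rw [podlesPow_neg_natCast]
    induction m with
    | zero => exact ⟨1, one_ne_zero, by simp⟩
    | succ m ih =>
      obtain ⟨h, hh, e⟩ := ih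
      obtain ⟨h', hh', e'⟩ := shiftRep_Bstar_single q (-m) h hh
      refine ⟨h', hh', ?_⟩
      rw [pow_succ', map_mul, map_mul, Module.End.mul_apply, e, e', Nat.cast_succ, neg_add,
        sub_eq_add_neg]

/-- At position n, the image of a normal form applied to the sequence supported at 0 is pₙ evaluated
at a nonzero multiple of X, times a nonzero polynomial. If this vanishes for all n, all pₙ vanish.
Linear independence of the normal forms is not needed beforehand; surjectivity onto the Podleś
sphere suffices. -/
theorem podlesHom_injective : Function.Injective (podlesHom q) := by
  have hq : (q : ℂ) ≠ 0 := by exact_mod_cast NeZero.ne q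
  rw [injective_iff_map_eq_zero]
  intro u hu
  obtain ⟨y, rfl⟩ := podlesNormalForm_surjective q u
  choose h hh e using exists_shiftRep_podlesPow q
  have key : ∀ (y : ℤ →₀ ℂ[X]) (n : ℤ),
      shiftRep q (podlesHom q (podlesNormalForm q y)) (Pi.single 0 1) n =
        (y n).comp (C (-((q : ℂ) ^ (-1 - 2 * n))) * X) * h n := by
    intro y n
    induction y using Finsupp.induction_linear with
    | zero => simp
    | add y z hy hz =>
      simp only [map_add, LinearMap.add_apply, Pi.add_apply, Finsupp.add_apply,
        Polynomial.add_comp, add_mul, hy, hz]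
    | single m p =>
      rw [podlesNormalForm_single, map_mul, map_mul, Module.End.mul_apply, e, shiftRep_aeval]
      by_cases hmn : m = n
      · subst hmn; simp
      · rw [Finsupp.single_eq_of_ne (Ne.symm hmn), Pi.single_eq_of_ne (Ne.symm hmn)]; simp
  have hy : y = 0 := by
    ext1 n
    have h0 := key y n
    rw [hu, map_zero, LinearMap.zero_apply, Pi.zero_apply] at h0
    -- Rescaling the variable by a nonzero constant is injective on ℂ[X], so only the vanishing of
    -- pₙ is possible.
    rcases mul_eq_zero.1 h0.symm with h1 | h1
    · exact (Polynomial.comp_C_mul_X_eq_zero_iff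
        (mem_nonZeroDivisors_of_ne_zero (neg_ne_zero.2 (zpow_ne_zero _ hq)))).1 h1
    · exact absurd h1 (hh n)
  rw [hy, map_zero]

/-- The isomorphism of the Podleś sphere with the invariants of `S_q^3`. -/
def podlesEquiv : Podles q ≃ₐ[ℂ] invariants (sphereCoaction q) :=
  AlgEquiv.ofBijective ((podlesHom q).codRestrict _ (podlesHom_mem_invariants q))
    ⟨fun _ _ h => podlesHom_injective q (congrArg Subtype.val h), fun ⟨u, hu⟩ => by
      obtain ⟨p, rfl⟩ := invariants_le_range_podlesHom q hu
      exact ⟨p, rfl⟩⟩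

end

end QuantumHopf

end

/-! ### Assembly of the theorem -/

open QuantumHopf in
theorem corollary3p6 (q : ℝ) [NeZero q] :
    -- `S_q^3 ≅ SU_q(2)` as `⋆`-algebras
    ∃ Θ : QSphere 2 q ≃ₐ[ℂ] SUq 2 q,
      (∀ u, Θ (star u) = star (Θ u)) ∧ (∀ i, Θ (QSphere.x q i) = SUq.t q 1 i) ∧
    -- `S_q^1 ≅ U_q(1)` as Hopf `⋆`-algebras
    ∃ φ : QSphere 1 q ≃ₐc[ℂ] ℂ[T;T⁻¹],
      (∀ u, φ (star u) = star (φ u)) ∧ φ (QSphere.x q 0) = LaurentPolynomial.T 1 ∧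
    -- the surjective Hopf `⋆`-algebra map `SU_q(2) → U_q(1)`, which is exact
    ∃ δ : SUq 2 q →ₐc[ℂ] ℂ[T;T⁻¹],
      (∀ u, δ (star u) = star (δ u)) ∧
      δ (SUq.t q 0 0) = star (LaurentPolynomial.T 1) ∧ δ (SUq.t q 0 1) = 0 ∧
      δ (SUq.t q 1 0) = 0 ∧ δ (SUq.t q 1 1) = LaurentPolynomial.T 1 ∧
      Function.Surjective δ ∧ IsExactHopfMap δ ∧
    -- the coaction of `S_q^1` on `S_q^3`, a `⋆`-map which corresponds to `(δ ⊗ id) ∘ Δ`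
    ∃ β : QSphere 2 q →ₐ[ℂ] QSphere 1 q ⊗[ℂ] QSphere 2 q,
      (∀ u, β (star u) = star (β u)) ∧
      (∀ i, β (QSphere.x q i) = QSphere.x q 0 ⊗ₜ[ℂ] QSphere.x q i) ∧
      (∀ u, TensorProduct.map (φ : QSphere 1 q →ₗ[ℂ] ℂ[T;T⁻¹]) Θ.toLinearMap (β u) =
        homogeneousCoaction δ (Θ u)) ∧
    -- it is a quantum principal bundle whose base is the Podleś sphere
      IsQuantumPrincipalBundle β ∧
      ∃ e : Podles q ≃ₐ[ℂ] invariants β, ∀ p, (e (star p) : QSphere 2 q) = star (e p : QSphere 2 q) := by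
  exact ⟨sphereEquiv q, sphereEquiv_star q, sphereEquiv_x q, circleEquiv q, circleEquiv_star q,
    circleEquiv_x q 0, torusHom q, torusHom_star q, by simp [torusHom_t], by simp [torusHom_t],
    by simp [torusHom_t], by simp [torusHom_t], torusHom_surjective q, torusHom_isExact q,
    sphereCoaction q, sphereCoaction_star q, sphereCoaction_x q, map_sphereCoaction q,
    sphereCoaction_isQuantumPrincipalBundle, podlesEquiv q, podlesHom_star q⟩
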